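/- Let $(X,\mathsf d)$ be a complete metric space and let $m$ be a doubling Borel measure on $X$, i.e. $0<m(B_r(x))<\infty$ for all $x\in X$, $r>0$, and there is a constant $C$ with $m(B_{2r}(x))\le C\,m(B_r(x))$ for all $x\in X$, $r>0$. For $f:X\to\mathbb R$ let $|\nabla f|(x)=\limsup_{y\to x}\frac{|f(y)-f(x)|}{\mathsf d(y,x)}$ be its slope ($0$ at isolated points), and for $f\in L^1(X,m)$ let $$\mathrm{Var}(f)=\inf\Big\{\liminf_{n\to\infty}\int_X|\nabla f_n|\,dm:\ f_n\in\mathrm{Lip}(X),\ \lim_{n\to\infty}\int_X|f_n-f|\,dm=0\Big\}.$$ For a Borel set $A$ with $m(A)<\infty$ the perimeter is $P(A)=\mathrm{Var}(\chi_A)$, and for $U\subset X$ open put $$P(A,U)=\inf\Big\{\liminf_{n\to\infty}\int_U|\nabla f_n|\,dm:\ f_n\in\mathrm{Lip}_{\rm loc}(U),\ \lim_{n\to\infty}\int_U|f_n-\chi_A|\,dm=0\Big\}.$$ When these values are the restriction to open sets of a finite Borel measure, that (unique) measure is denoted $P(A,\cdot)$ and called the perimeter measure of $A$. Let $S^h$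 be the Borel measure obtained by Carathéodory's construction from the gauge $\zeta(\overline B_r(x))=\frac{m(\overline B_r(x))}{2r}$ on closed balls, i.e. $S^h=\sup_{\delta>0}S^h_\delta$, where $S^h_\delta(A)$ is the infimum of $\sum_i\frac{m(\overline B_{r_i}(x_i))}{2r_i}$ over all countable covers of $A$ by closed balls $\overline B_{r_i}(x_i)$ with $0<r_i<\delta$. The essential boundary $\partial^*E$ is the complement of the set of points $x$ at which $\frac{m(B_r(x)\cap E)}{m(B_r(x))}$ tends to $1$ or to $0$ as $r\downarrow0$. Assume that $$\mathrm{Var}(f)=\int_X|\nabla f|\,dm\qquad\text{for every Lipschitz } f\in L^1(X,m).\tag{13}$$ Then for every Lipschitz function $f:X\to[0,\infty)$ with $m(\{f>0\})<\infty$ and for $\mathcal L^1$-a.e. $t\in(0,\infty)$, the set $E_t=\{f\ge t\}$ has finite perimeter, $P(E_t)<\infty$, its perimeter measure $P(E_t,\cdot)$ exists as a finite Borel measure, and $$P(E_t,\cdot)\ \ge\ \tfrac12\,S^h\llcorner\partial^*E_t .$$ -/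

import Mathlib

open MeasureTheory Filter Topology Set
open scoped ENNReal NNReal

namespace MetricBV

section Variation

variable {X : Type*} [MetricSpace X]

/-- The slope (local Lipschitz constant) `limsup_{y → x} |f y - f x| / d (y, x)`, with values in
`[0, ∞]`. At an isolated point the punctured neighbourhood filter is trivial and the value is `0`. -/
noncomputable def slope (f : X → ℝ) (x : X) : ℝ≥0∞ :=
  limsup (fun y => ENNReal.ofReal (|f y - f x| / dist y x)) (𝓝[≠] x)

variable [MeasurableSpace X]

/-- A doubling measure: all balls have positive and finite measure (so bounded sets have finite
measure), and `m (B_{2r}(x)) ≤ C m (B_r(x))` for all centres and all radii. -/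
def IsDoubling (m : Measure X) : Prop :=
  (∀ (x : X) (r : ℝ), 0 < r → 0 < m (Metric.ball x r) ∧ m (Metric.ball x r) < ∞) ∧
  ∃ C : ℝ≥0, ∀ (x : X) (r : ℝ), 0 < r → m (Metric.ball x (2 * r)) ≤ C * m (Metric.ball x r)

/-- The total variation of `f`: the infimum of `liminf ∫ slope (u n) dm` over all sequences of
Lipschitz functions `u n` on `X` with `∫ |u n - f| dm → 0`. -/
noncomputable def totalVariation (m : Measure X) (f : X → ℝ) : ℝ≥0∞ :=
  ⨅ (u : ℕ → X → ℝ) (_ : ∀ n, ∃ K : ℝ≥0, LipschitzWith K (u n))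
    (_ : Tendsto (fun n => ∫⁻ x, ENNReal.ofReal |u n x - f x| ∂m) atTop (𝓝 0)),
    liminf (fun n => ∫⁻ x, slope (u n) x ∂m) atTop

/-- The regularity assumption on the metric measure space: the total variation of every integrable
Lipschitz function is the integral of its slope. -/
def VariationEqSlope (m : Measure X) : Prop :=
  ∀ f : X → ℝ, (∃ K : ℝ≥0, LipschitzWith K f) → Integrable f m →
    totalVariation m f = ∫⁻ x, slope f x ∂m

/-- The perimeter of `A`: the total variation of its characteristic function. -/
noncomputable def perimeter (m : Measure X) (A : Set X) : ℝ≥0∞ :=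
  totalVariation m (A.indicator fun _ => (1 : ℝ))

/-- The perimeter of `A` in an open set `U`: the infimum of `liminf ∫_U slope (u n) dm` over all
sequences of locally Lipschitz functions `u n` on `U` with `∫_U |u n - χ_A| dm → 0`.
A function on `U` is represented by any extension of it to `X`; since `U` is open, the slope at the
points of `U` does not depend on the extension. -/
noncomputable def perimeterIn (m : Measure X) (A U : Set X) : ℝ≥0∞ :=
  ⨅ (u : ℕ → X → ℝ) (_ : ∀ n, LocallyLipschitzOn U (u n))
    (_ : Tendsto
      (fun n => ∫⁻ x in U, ENNReal.ofReal |u n x - A.indicator (fun _ => (1 : ℝ)) x| ∂m)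
      atTop (𝓝 0)),
    liminf (fun n => ∫⁻ x in U, slope (u n) x ∂m) atTop

/-- `P` is the perimeter measure `P(A, ·)`: the finite Borel measure whose value at each open set
`U` is the perimeter of `A` in `U`. It is unique, see `IsPerimeterMeasure.unique`. -/
structure IsPerimeterMeasure (m : Measure X) (A : Set X) (P : Measure X) : Prop where
  finite : IsFiniteMeasure P
  apply_open : ∀ U : Set X, IsOpen U → P U = perimeterIn m A U

theorem IsPerimeterMeasure.unique [BorelSpace X] {m : Measure X} {A : Set X} {P Q : Measure X}
    (hP : IsPerimeterMeasure m A P) (hQ : IsPerimeterMeasure m A Q) : P = Q := by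
  have := hP.finite
  refine ext_of_generate_finite {U : Set X | IsOpen U} (BorelSpace.measurable_eq (α := X))
    (fun s hs t ht _ => IsOpen.inter hs ht) (fun U hU => ?_) ?_
  · rw [hP.apply_open U hU, hQ.apply_open U hU]
  · rw [hP.apply_open _ isOpen_univ, hQ.apply_open _ isOpen_univ]

/-- Points `x` with `m (B_r(x) ∩ E) / m (B_r(x)) → θ` as `r ↓ 0`. -/
def densityPoints (m : Measure X) (E : Set X) (θ : ℝ≥0∞) : Set X :=
  {x | Tendsto (fun r : ℝ => m (Metric.ball x r ∩ E) / m (Metric.ball x r)) (𝓝[>] 0) (𝓝 θ)}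

/-- The essential boundary of `E`: the complement of the union of the set of density points and
the set of rarefaction points of `E`. -/
def essBoundary (m : Measure X) (E : Set X) : Set X :=
  (densityPoints m E 1 ∪ densityPoints m E 0)ᶜ

end Variation

section Spherical

variable {X : Type*} [MetricSpace X] [MeasurableSpace X]

/-- The size-`δ` outer measure of Carathéodory's construction with closed balls and the gauge
`m (closedBall x r) / (2 r)`: the infimum of the sums of the gauge over countable covers by closed
balls of radius `r ∈ (0, δ)`. Sets that are not such balls get the gauge `∞`, and `boundedBy` gives
the empty set the value `0`. -/
noncomputable def sphericalPre (m : Measure X) (δ : ℝ) : OuterMeasure X :=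
  OuterMeasure.boundedBy fun s =>
    ⨅ (x : X) (r : ℝ) (_ : 0 < r) (_ : r < δ) (_ : s = Metric.closedBall x r),
      m s / ENNReal.ofReal (2 * r)

/-- The outer measure `S^h`, the supremum (limit as `δ ↓ 0`) of the size-`δ` outer measures. -/
noncomputable def sphericalOuter (m : Measure X) : OuterMeasure X :=
  ⨆ (δ : ℝ) (_ : 0 < δ), sphericalPre m δ

theorem sphericalPre_anti (m : Measure X) {δ δ' : ℝ} (h : δ ≤ δ') :
    sphericalPre m δ' ≤ sphericalPre m δ := by
  refine OuterMeasure.le_boundedBy.2 fun s => (OuterMeasure.boundedBy_le s).trans ?_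
  refine iInf_mono fun x => iInf_mono fun r => iInf_mono fun _ => ?_
  exact le_iInf fun hr => iInf_le _ (hr.trans_le h)

theorem sphericalOuter_isMetric (m : Measure X) : (sphericalOuter m).IsMetric := by
  rintro s t ⟨c, c0, hc⟩
  refine le_antisymm (measure_union_le s t) ?_
  obtain ⟨ε, hε, hεc⟩ : ∃ ε : ℝ, 0 < ε ∧ ENNReal.ofReal (2 * ε) ≤ c := by
    by_cases h : c = ∞
    · exact ⟨1, one_pos, h ▸ le_top⟩
    · refine ⟨c.toReal / 2, half_pos (ENNReal.toReal_pos c0 h), ?_⟩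
      rw [mul_div_cancel₀ _ two_ne_zero, ENNReal.ofReal_toReal h]
  have key : ∀ δ : ℝ, δ ≤ ε →
      sphericalPre m δ (s ∪ t) = sphericalPre m δ s + sphericalPre m δ t := by
    intro δ hδ
    refine OuterMeasure.boundedBy_union_of_top_of_nonempty_inter ?_
    rintro u ⟨y, hys, hyu⟩ ⟨z, hzt, hzu⟩
    simp only [iInf_eq_top]
    rintro x r _ hrδ rfl
    exfalso
    have h1 := (hεc.trans (hc y hys z hzt))
    rw [edist_dist, ENNReal.ofReal_le_ofReal_iff dist_nonneg] at h1
    have h2 := dist_triangle_right y z x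
    have h3 := Metric.mem_closedBall.1 hyu
    have h4 := Metric.mem_closedBall.1 hzu
    linarith
  simp only [sphericalOuter, OuterMeasure.iSup_apply]
  refine ENNReal.biSup_add_biSup_le' ⟨1, one_pos⟩ ⟨1, one_pos⟩ fun i hi j hj => ?_
  have hpos : 0 < min ε (min i j) := lt_min hε (lt_min hi hj)
  refine le_trans ?_ (le_iSup₂ (f := fun (δ : ℝ) (_ : 0 < δ) => sphericalPre m δ (s ∪ t)) _ hpos)
  rw [key _ (min_le_left _ _)]
  exact add_le_add
    (sphericalPre_anti m ((min_le_right _ _).trans (min_le_left _ _)) s)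
    (sphericalPre_anti m ((min_le_right _ _).trans (min_le_right _ _)) t)

/-- The Borel measure `S^h` given by Carathéodory's construction. -/
noncomputable def sphericalMeasure [BorelSpace X] (m : Measure X) : Measure X :=
  (sphericalOuter m).toMeasure (sphericalOuter_isMetric m).le_caratheodory

end Spherical

end MetricBV

/-!
# Perimeters of superlevel sets dominate the spherical measure of the essential boundary

Write `p t U` for the perimeter of `{t ≤ f}` in the open set `U`, fix `a > 0`, and let
`slopeMeasure m f a` be the finite measure `slope f • m` on `{a < f}`. The proof shows
that for almost every `t > a` the perimeter of `{t ≤ f}` is the density at `t` of this measure with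
respect to the values of `f`, and that the same density bounds the spherical measure of `{f = t}`.

*Coarea formula.* The functions rising linearly from `0` to `1` between the levels `t - h` and `t`
show that `p t U` is at most the density at `t` of the distribution of `f` under
`slopeMeasure m f a` restricted to `U` (`ae_perimeterIn_le_rnDeriv`). Conversely, a truncation of `f`
is a limit of convex combinations of characteristic functions of superlevel sets, and the assumption
that the variation of Lipschitz functions is the integral of the slope makes this integral lower
semicontinuous; since the slope is local, this persists in every open set
(`VariationEqSlope.lintegral_slope_le_liminf`). So `p t U` equals the density for almost every `t`, and
the distribution is absolutely continuous (`VariationEqSlope.coarea`).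

*Perimeter measure.* Disintegrating `slopeMeasure m f a` along the level sets of `f` gives finite
measures `P t` with `P t U = p t U` for almost every `t`, simultaneously for the members `U` of a
countable family that exhausts all open sets. This yields `P t U ≤ p t U` for every open `U`. The
energies of the linear approximations then converge weakly to `P t`, and gluing the approximations with
a partition of unity of `U` gives the reverse inequality (`perimeterIn_le_of_tendsto`). Thus `P t` is
the perimeter measure, without a general extension theorem for set functions on open sets.

*Spherical measure.* If `|f y - f x| ≤ L r` on a closed ball `B` of radius `r`, the levels attained on
`B` fill an interval of length at most `2 L r`, and `2 L r` times the gauge `m B / (2 r)` is `L * m B`.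
Covering an open set by small disjoint balls whose centres are Lebesgue points of the slope, up to a
null set that contributes nothing, bounds the integral over `t` of the spherical measure of
`U ∩ {f = t}` by the integral of the slope (`IsDoubling.exists_sphericalOuter_le`). Hence
`sphericalMeasure m (U ∩ {f = t}) ≤ P t U` for almost every `t`, first on the countable family and then,
by outer regularity of `P t`, on all Borel sets. The essential boundary of `{t ≤ f}` lies in `{f = t}`.
This argument gives the inequality with constant `1` in place of `1 / 2`.
-/

namespace MetricBV

/-! ### Calculus of the slope -/

section Slope

variable {X : Type*} [MetricSpace X]

theorem slope_le_of_eventually {f : X → ℝ} {x : X} {c : ℝ}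
    (h : ∀ᶠ y in 𝓝 x, |f y - f x| ≤ c * dist y x) : slope f x ≤ ENNReal.ofReal c := by
  refine limsup_le_of_le (by isBoundedDefault) ?_
  filter_upwards [h.filter_mono nhdsWithin_le_nhds, self_mem_nhdsWithin] with y hy hne
  exact ENNReal.ofReal_le_ofReal ((div_le_iff₀ (dist_pos.2 hne)).2 hy)

theorem eventually_of_slope_lt {f : X → ℝ} {x : X} {c : ℝ} (h : slope f x < ENNReal.ofReal c) :
    ∀ᶠ y in 𝓝 x, |f y - f x| ≤ c * dist y x := by
  have h1 := eventually_nhdsWithin_iff.1 (eventually_lt_of_limsup_lt h)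
  filter_upwards [h1] with y hy
  rcases eq_or_ne y x with rfl | hne
  · simp
  · have h2 := hy hne
    have hc : 0 < c := by
      by_contra hc
      rw [ENNReal.ofReal_of_nonpos (not_lt.1 hc)] at h
      exact absurd h not_lt_zero
    exact ((div_lt_iff₀ (dist_pos.2 hne)).1 ((ENNReal.ofReal_lt_ofReal_iff hc).1 h2)).le

theorem eventually_of_slope_ne_top {f : X → ℝ} {x : X} (h : slope f x ≠ ∞) {ε : ℝ} (hε : 0 < ε) :
    ∀ᶠ y in 𝓝 x, |f y - f x| ≤ ((slope f x).toReal + ε) * dist y x := by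
  refine eventually_of_slope_lt ?_
  conv_lhs => rw [← ENNReal.ofReal_toReal h]
  exact (ENNReal.ofReal_lt_ofReal_iff (by positivity)).2 (by linarith)

theorem slope_le_of_forall_pos {f : X → ℝ} {x : X} {P : ℝ → ℝ} (hP : ContinuousAt P 0)
    (h : ∀ ε > 0, ∀ᶠ y in 𝓝 x, |f y - f x| ≤ P ε * dist y x) : slope f x ≤ ENNReal.ofReal (P 0) := by
  have h1 : Tendsto (fun ε => ENNReal.ofReal (P ε)) (𝓝[>] 0) (𝓝 (ENNReal.ofReal (P 0))) :=
    ((ENNReal.continuous_ofReal.tendsto _).comp hP).mono_left nhdsWithin_le_nhds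
  refine ge_of_tendsto h1 ?_
  filter_upwards [self_mem_nhdsWithin] with ε hε using slope_le_of_eventually (h ε hε)

theorem slope_congr {f g : X → ℝ} {x : X} (h : f =ᶠ[𝓝 x] g) : slope f x = slope g x := by
  refine limsup_congr ?_
  filter_upwards [h.filter_mono nhdsWithin_le_nhds] with y hy
  rw [hy, h.self_of_nhds]

theorem slope_eq_zero_of_eventually_eq_const {f : X → ℝ} {x : X} {c : ℝ}
    (h : ∀ᶠ y in 𝓝 x, f y = c) : slope f x = 0 := by
  rw [← nonpos_iff_eq_zero, ← ENNReal.ofReal_zero]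
  refine slope_le_of_eventually ?_
  filter_upwards [h] with y hy
  simp [hy, h.self_of_nhds]

theorem slope_sub_const (f : X → ℝ) (c : ℝ) (x : X) : slope (fun y => f y - c) x = slope f x := by
  simp [slope]

theorem slope_add_le (f g : X → ℝ) (x : X) :
    slope (fun y => f y + g y) x ≤ slope f x + slope g x := by
  by_cases hf : slope f x = ∞
  · simp [hf]
  by_cases hg : slope g x = ∞
  · simp [hg]
  have : slope f x + slope g x
      = ENNReal.ofReal ((slope f x).toReal + 0 + ((slope g x).toReal + 0)) := by
    rw [add_zero, add_zero, ENNReal.ofReal_add (by positivity) (by positivity),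
      ENNReal.ofReal_toReal hf, ENNReal.ofReal_toReal hg]
  rw [this]
  refine slope_le_of_forall_pos (P := fun ε => (slope f x).toReal + ε + ((slope g x).toReal + ε))
    (by fun_prop) fun ε hε => ?_
  filter_upwards [eventually_of_slope_ne_top hf hε, eventually_of_slope_ne_top hg hε] with y h1 h2
  rw [add_mul]
  refine le_trans ?_ (add_le_add h1 h2)
  rw [add_sub_add_comm]
  exact abs_add_le _ _

theorem slope_sum_le {ι : Type*} (s : Finset ι) (F : ι → X → ℝ) (x : X) :
    slope (fun y => ∑ j ∈ s, F j y) x ≤ ∑ j ∈ s, slope (F j) x := by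
  classical
  induction s using Finset.induction_on with
  | empty => simpa using (slope_eq_zero_of_eventually_eq_const (c := 0) (by simp)).le
  | insert a s ha ih =>
    simp only [Finset.sum_insert ha]
    exact (slope_add_le _ _ _).trans (by gcongr)

/-- The Leibniz rule; the weight of `slope v` is the value of `φ` at the point. -/
theorem slope_mul_le {φ v : X → ℝ} {x : X} (hφ : slope φ x ≠ ∞) (hv : slope v x ≠ ∞) :
    slope (fun y => φ y * v y) x
      ≤ ENNReal.ofReal |φ x| * slope v x + ENNReal.ofReal |v x| * slope φ x := by
  set a := (slope v x).toReal with ha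
  set b := (slope φ x).toReal with hb
  have ha0 : 0 ≤ a := ENNReal.toReal_nonneg
  have hb0 : 0 ≤ b := ENNReal.toReal_nonneg
  have : ENNReal.ofReal |φ x| * slope v x + ENNReal.ofReal |v x| * slope φ x
      = ENNReal.ofReal ((|φ x| + 0) * (a + 0) + |v x| * (b + 0)) := by
    rw [add_zero, add_zero, add_zero, ENNReal.ofReal_add (by positivity) (by positivity),
      ENNReal.ofReal_mul (by positivity), ENNReal.ofReal_mul (by positivity),
      ENNReal.ofReal_toReal hv, ENNReal.ofReal_toReal hφ]
  rw [this]
  refine slope_le_of_forall_pos (P := fun ε => (|φ x| + ε) * (a + ε) + |v x| * (b + ε))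
    (by fun_prop) fun ε hε => ?_
  have hsmall : ∀ᶠ y in 𝓝 x, (b + ε) * dist y x < ε := by
    have : Tendsto (fun y => (b + ε) * dist y x) (𝓝 x) (𝓝 ((b + ε) * dist x x)) :=
      Continuous.tendsto (by fun_prop) x
    rw [dist_self, mul_zero] at this
    exact this.eventually_lt_const hε
  filter_upwards [eventually_of_slope_ne_top hφ hε, eventually_of_slope_ne_top hv hε, hsmall]
    with y h1 h2 h3
  have h4 : |φ y| ≤ |φ x| + ε := by
    have := abs_sub_abs_le_abs_sub (φ y) (φ x)
    linarith
  calc |φ y * v y - φ x * v x| = |φ y * (v y - v x) + v x * (φ y - φ x)| := by ring_nf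
    _ ≤ |φ y| * |v y - v x| + |v x| * |φ y - φ x| := by
        rw [← abs_mul, ← abs_mul]; exact abs_add_le _ _
    _ ≤ (|φ x| + ε) * ((a + ε) * dist y x) + |v x| * ((b + ε) * dist y x) := by gcongr
    _ = _ := by ring

theorem slope_const_mul_le (c : ℝ) {v : X → ℝ} {x : X} (hv : slope v x ≠ ∞) :
    slope (fun y => c * v y) x ≤ ENNReal.ofReal |c| * slope v x := by
  have h0 : slope (fun _ : X => c) x = 0 := slope_eq_zero_of_eventually_eq_const (c := c) (by simp)
  simpa [h0] using slope_mul_le (φ := fun _ => c) (by simp [h0]) hv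

theorem slope_le_of_abs_sub_le {f g : X → ℝ} {x : X} (h : ∀ y, |f y - f x| ≤ |g y - g x|) :
    slope f x ≤ slope g x :=
  limsup_le_limsup (Eventually.of_forall fun y =>
    ENNReal.ofReal_le_ofReal (div_le_div_of_nonneg_right (h y) dist_nonneg))

theorem slope_le_of_lipschitzOn {f : X → ℝ} {x : X} {K : ℝ≥0} {s : Set X} (hs : s ∈ 𝓝 x)
    (h : LipschitzOnWith K f s) : slope f x ≤ K := by
  rw [← ENNReal.ofReal_coe_nnreal]
  refine slope_le_of_eventually ?_
  filter_upwards [hs] with y hy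
  simpa [Real.dist_eq] using h.dist_le_mul y hy x (mem_of_mem_nhds hs)

theorem slope_le_of_lipschitz {f : X → ℝ} {K : ℝ≥0} (h : LipschitzWith K f) (x : X) :
    slope f x ≤ K :=
  slope_le_of_lipschitzOn univ_mem h.lipschitzOnWith

theorem slope_ne_top_of_locallyLipschitzOn {f : X → ℝ} {U : Set X} (hU : IsOpen U)
    (hf : LocallyLipschitzOn U f) {x : X} (hx : x ∈ U) : slope f x ≠ ∞ := by
  obtain ⟨K, s, hs, h⟩ := hf hx
  rw [hU.nhdsWithin_eq hx] at hs
  exact ((slope_le_of_lipschitzOn hs h).trans_lt ENNReal.coe_lt_top).ne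

/-- Difference quotients at scale less than `r`. -/
noncomputable def slopeAtScale (f : X → ℝ) (r : ℝ) (x : X) : ℝ≥0∞ :=
  ⨆ y ∈ Metric.ball x r \ {x}, ENNReal.ofReal (|f y - f x| / dist y x)

theorem slope_eq_iInf_slopeAtScale (f : X → ℝ) (x : X) :
    slope f x = ⨅ n : ℕ, slopeAtScale f (1 / (n + 1)) x := by
  have hb : (𝓝[≠] x).HasBasis (fun _ : ℕ => True) fun n => Metric.ball x (1 / (n + 1)) \ {x} := by
    have := (Metric.nhds_basis_ball_inv_nat_succ (x := x)).inf_principal {x}ᶜ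
    simpa only [sdiff_eq, nhdsWithin] using this
  rw [slope, hb.limsup_eq_iInf_iSup]
  simp [slopeAtScale]

theorem isOpen_slopeAtScale_gt {f : X → ℝ} {U : Set X} (hU : IsOpen U) (hf : ContinuousOn f U)
    (r : ℝ) (c : ℝ≥0∞) : IsOpen {x ∈ U | c < slopeAtScale f r x} := by
  rw [isOpen_iff_mem_nhds]
  rintro x ⟨hxU, hx⟩
  simp only [slopeAtScale, lt_iSup_iff] at hx
  obtain ⟨y, ⟨hyb, hyx⟩, hc⟩ := hx
  have hyx' : y ≠ x := hyx
  have hcont : ContinuousAt (fun z => ENNReal.ofReal (|f y - f z| / dist y z)) x := by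
    refine ENNReal.continuous_ofReal.continuousAt.comp ?_
    have hfx : ContinuousAt f x := hf.continuousAt (hU.mem_nhds hxU)
    exact ((continuousAt_const.sub hfx).abs).div (by fun_prop) (dist_pos.2 hyx').ne'
  have h1 : ∀ᶠ z in 𝓝 x, y ∈ Metric.ball z r := by
    have : Tendsto (fun z => dist y z) (𝓝 x) (𝓝 (dist y x)) := Continuous.tendsto (by fun_prop) x
    exact this.eventually_lt_const hyb
  have h2 : ∀ᶠ z in 𝓝 x, y ≠ z := (eventually_ne_nhds hyx'.symm).mono fun z hz => Ne.symm hz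
  filter_upwards [h1, h2, hU.mem_nhds hxU, hcont.tendsto.eventually_const_lt hc] with z a1 a2 a3 a4
  refine ⟨a3, a4.trans_le ?_⟩
  exact le_iSup₂ (f := fun y _ => ENNReal.ofReal (|f y - f z| / dist y z)) y ⟨a1, a2⟩

variable [MeasurableSpace X] [BorelSpace X]

theorem measurable_indicator_slope {f : X → ℝ} {U : Set X} (hU : IsOpen U)
    (hf : ContinuousOn f U) : Measurable (U.indicator (slope f)) := by
  have h1 : U.indicator (slope f) =
      fun x => ⨅ n : ℕ, U.indicator (slopeAtScale f (1 / (n + 1))) x := by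
    funext x
    by_cases hx : x ∈ U
    · simp [hx, slope_eq_iInf_slopeAtScale]
    · simp [hx]
  rw [h1]
  refine Measurable.iInf fun n => measurable_of_Ioi fun c => ?_
  convert (isOpen_slopeAtScale_gt hU hf (1 / (n + 1)) c).measurableSet using 1
  ext x
  by_cases hx : x ∈ U <;> simp [hx]

theorem aemeasurable_slope_restrict {m : Measure X} {f : X → ℝ} {U : Set X} (hU : IsOpen U)
    (hf : ContinuousOn f U) : AEMeasurable (slope f) (m.restrict U) :=
  (aemeasurable_indicator_iff hU.measurableSet).1 (measurable_indicator_slope hU hf).aemeasurable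

theorem measurable_slope {f : X → ℝ} (hf : Continuous f) : Measurable (slope f) := by
  simpa using measurable_indicator_slope isOpen_univ hf.continuousOn

end Slope

/-! ### Doubling measures -/

section Doubling

variable {X : Type*} [MetricSpace X] [MeasurableSpace X] {m : Measure X}

theorem IsDoubling.exists_measure_ball_two_pow_mul_le (hm : IsDoubling m) :
    ∃ C : ℝ≥0, ∀ (k : ℕ) (x : X) (r : ℝ), 0 < r →
      m (Metric.ball x (2 ^ k * r)) ≤ C ^ k * m (Metric.ball x r) := by
  obtain ⟨-, C, hC⟩ := hm
  refine ⟨C, fun k => ?_⟩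
  induction k with
  | zero => intro x r _; simp
  | succ k ih =>
    intro x r hr
    have h1 := hC x (2 ^ k * r) (by positivity)
    calc m (Metric.ball x (2 ^ (k + 1) * r)) = m (Metric.ball x (2 * (2 ^ k * r))) := by ring_nf
      _ ≤ C * m (Metric.ball x (2 ^ k * r)) := h1
      _ ≤ C * (C ^ k * m (Metric.ball x r)) := by gcongr; exact ih x r hr
      _ = _ := by ring

theorem IsDoubling.isUnifLocDoublingMeasure (hm : IsDoubling m) : IsUnifLocDoublingMeasure m := by
  obtain ⟨C, hC⟩ := hm.exists_measure_ball_two_pow_mul_le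
  refine ⟨⟨C ^ 2, ?_⟩⟩
  filter_upwards [self_mem_nhdsWithin] with r hr x
  have hr : 0 < r := hr
  calc m (Metric.closedBall x (2 * r)) ≤ m (Metric.ball x (2 ^ 2 * r)) :=
        measure_mono (Metric.closedBall_subset_ball (by linarith))
    _ ≤ C ^ 2 * m (Metric.ball x r) := hC 2 x r hr
    _ ≤ C ^ 2 * m (Metric.closedBall x r) := by gcongr; exact Metric.ball_subset_closedBall
    _ = _ := by push_cast; ring

/-- Disjoint balls of a fixed radius with centres in a bounded set have measure bounded from below,
so there are finitely many of them and their enlargements cover. -/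
theorem IsDoubling.totallyBounded_closedBall [BorelSpace X] (hm : IsDoubling m) (x : X) (R : ℝ) :
    TotallyBounded (Metric.closedBall x R) := by
  obtain ⟨C, hC⟩ := hm.exists_measure_ball_two_pow_mul_le
  refine Metric.totallyBounded_iff.2 fun ε hε => ?_
  obtain ⟨u, hu, hdisj, hcov⟩ := Vitali.exists_disjoint_subfamily_covering_enlargement_closedBall
    (Metric.closedBall x R) (fun y => y) (fun _ => ε / 10) (ε / 10) (fun _ _ => le_rfl) 5
    (by norm_num)
  set r := ε / 10 with hr
  have hr0 : 0 < r := by positivity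
  refine ⟨u, ?_, fun y hy => ?_⟩
  · rcases u.eq_empty_or_nonempty with rfl | ⟨y0, hy0⟩
    · exact finite_empty
    have hR : 0 ≤ R := dist_nonneg.trans (hu hy0)
    obtain ⟨k, hk⟩ := pow_unbounded_of_one_lt ((2 * R + r) / r) (one_lt_two)
    have hk' : 2 * R + r < 2 ^ k * r := (div_lt_iff₀ hr0).1 hk
    have hlow : ∀ y ∈ u, m (Metric.ball x r) / C ^ k ≤ m (Metric.closedBall y r) := by
      intro y hy
      refine ENNReal.div_le_of_le_mul' ?_
      calc m (Metric.ball x r) ≤ m (Metric.ball y (2 ^ k * r)) := by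
            refine measure_mono (Metric.ball_subset_ball' ?_)
            have : dist x y ≤ R := by rw [dist_comm]; exact hu hy
            linarith
        _ ≤ C ^ k * m (Metric.ball y r) := hC k y r hr0
        _ ≤ _ := by gcongr; exact Metric.ball_subset_closedBall
    have hfin := Measure.finite_const_le_meas_of_disjoint_iUnion m
      (ε := m (Metric.ball x r) / C ^ k)
      (ENNReal.div_pos (hm.1 x r hr0).1.ne' (by finiteness))
      (As := fun y : u => Metric.closedBall (y : X) r)
      (fun y => Metric.isClosed_closedBall.measurableSet)
      (fun a b hab => hdisj a.2 b.2 (fun h => hab (Subtype.ext h)))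
      (ne_top_of_le_ne_top (hm.1 x (R + r + 1) (by linarith)).2.ne
        (measure_mono (iUnion_subset fun y => by
          intro z hz
          have h1 : dist (y : X) x ≤ R := hu y.2
          have h2 : dist z y ≤ r := hz
          have := dist_triangle z y x
          exact Metric.mem_ball.2 (by linarith))))
    have huniv : (univ : Set u).Finite := hfin.subset fun y _ => hlow y y.2
    exact finite_coe_iff.1 (finite_univ_iff.1 huniv)
  · obtain ⟨b, hb, hsub⟩ := hcov y hy
    have := hsub (Metric.mem_closedBall_self hr0.le)
    refine mem_biUnion hb (Metric.mem_ball.2 ((Metric.mem_closedBall.1 this).trans_lt ?_))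
    rw [hr]; linarith

theorem IsDoubling.properSpace [BorelSpace X] [CompleteSpace X] (hm : IsDoubling m) :
    ProperSpace X :=
  ⟨fun x R => isCompact_iff_totallyBounded_isComplete.2
    ⟨hm.totallyBounded_closedBall x R, Metric.isClosed_closedBall.isComplete⟩⟩

theorem IsDoubling.isLocallyFiniteMeasure (hm : IsDoubling m) : IsLocallyFiniteMeasure m :=
  ⟨fun x => ⟨Metric.ball x 1, Metric.ball_mem_nhds x one_pos, (hm.1 x 1 one_pos).2⟩⟩

end Doubling

/-! ### Locally Lipschitz functions -/

section LocallyLipschitz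

variable {X : Type*} [MetricSpace X]

theorem _root_.LocallyLipschitzOn.add_real {U : Set X} {f g : X → ℝ} (hf : LocallyLipschitzOn U f)
    (hg : LocallyLipschitzOn U g) : LocallyLipschitzOn U fun x => f x + g x := by
  rw [locallyLipschitzOn_iff_restrict] at *
  exact (contDiff_add (𝕜 := ℝ) (n := 1)).locallyLipschitz.comp (hf.prodMk hg)

theorem _root_.LocallyLipschitzOn.mul_real {U : Set X} {f g : X → ℝ} (hf : LocallyLipschitzOn U f)
    (hg : LocallyLipschitzOn U g) : LocallyLipschitzOn U fun x => f x * g x := by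
  rw [locallyLipschitzOn_iff_restrict] at *
  exact (contDiff_mul (𝕜 := ℝ) (n := 1)).locallyLipschitz.comp (hf.prodMk hg)

theorem locallyLipschitzOn_const (U : Set X) (c : ℝ) : LocallyLipschitzOn U fun _ => c :=
  (LocallyLipschitz.const c).locallyLipschitzOn

theorem locallyLipschitzOn_sum {ι : Type*} (s : Finset ι) {U : Set X} {F : ι → X → ℝ}
    (h : ∀ i ∈ s, LocallyLipschitzOn U (F i)) : LocallyLipschitzOn U fun x => ∑ i ∈ s, F i x := by
  classical
  induction s using Finset.induction_on with
  | empty => simpa using locallyLipschitzOn_const U 0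
  | insert a s ha ih =>
    simp only [Finset.sum_insert ha]
    exact (h a (by simp)).add_real (ih fun i hi => h i (by simp [hi]))

theorem locallyLipschitzOn_of_eventuallyEq {U : Set X} {f : X → ℝ}
    (h : ∀ x ∈ U, ∃ g V, IsOpen V ∧ x ∈ V ∧ LocallyLipschitzOn V g ∧ f =ᶠ[𝓝 x] g) :
    LocallyLipschitzOn U f := by
  intro x hx
  obtain ⟨g, V, hV, hxV, hg, hfg⟩ := h x hx
  obtain ⟨K, s, hs, hK⟩ := hg hxV
  rw [hV.nhdsWithin_eq hxV] at hs
  refine ⟨K, s ∩ {y | f y = g y}, mem_nhdsWithin_of_mem_nhds (inter_mem hs hfg), ?_⟩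
  intro y hy z hz
  rw [hy.2, hz.2]
  exact hK hy.1 hz.1

theorem exists_lipschitzWith_of_eq_zero_off_compact [ProperSpace X] {v : X → ℝ} {K : Set X}
    (hv : LocallyLipschitz v) (hK : IsCompact K) (h0 : ∀ x ∉ K, v x = 0) :
    ∃ L : ℝ≥0, LipschitzWith L v := by
  have hK1 : IsCompact (Metric.cthickening 1 K) := hK.cthickening
  obtain ⟨L, hL⟩ := (hv.locallyLipschitzOn (s := Metric.cthickening 1 K)
    ).exists_lipschitzOnWith_of_compact hK1
  obtain ⟨M, hM⟩ := hK.exists_bound_of_continuousOn hv.continuous.continuousOn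
  have hsub : K ⊆ Metric.cthickening 1 K := Metric.self_subset_cthickening K
  have key : ∀ x ∈ K, ∀ y, dist (v x) (v y) ≤ (max L M.toNNReal : ℝ≥0) * dist x y := by
    intro x hx y
    by_cases hy : y ∈ Metric.cthickening 1 K
    · refine (hL.dist_le_mul x (hsub hx) y hy).trans ?_
      gcongr
      exact le_max_left _ _
    · have hyK : y ∉ K := fun h => hy (hsub h)
      have hd : 1 ≤ dist x y := by
        by_contra hd
        exact hy (Metric.mem_cthickening_of_dist_le y x 1 K hx (by rw [dist_comm]; linarith))
      rw [h0 y hyK, dist_zero_right]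
      have h1 : M ≤ (max L M.toNNReal : ℝ≥0) := by
        push_cast
        exact (Real.le_coe_toNNReal M).trans (le_max_right _ _)
      calc ‖v x‖ ≤ M := hM x hx
        _ ≤ (max L M.toNNReal : ℝ≥0) := h1
        _ ≤ _ := le_mul_of_one_le_right (by positivity) hd
  refine ⟨max L M.toNNReal, LipschitzWith.of_dist_le_mul fun x y => ?_⟩
  by_cases hx : x ∈ K
  · exact key x hx y
  by_cases hy : y ∈ K
  · rw [dist_comm, dist_comm x]
    exact key y hy x
  · rw [h0 x hx, h0 y hy, dist_self]
    positivity

theorem exists_lipschitz_cutoff [ProperSpace X] {K U : Set X} (hK : IsCompact K) (hU : IsOpen U)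
    (hKU : K ⊆ U) : ∃ (φ : X → ℝ) (L : ℝ≥0) (K' : Set X), LipschitzWith L φ ∧ (∀ x, 0 ≤ φ x) ∧
      (∀ x, φ x ≤ 1) ∧ (∀ x ∈ K, φ x = 1) ∧ IsCompact K' ∧ K' ⊆ U ∧ ∀ x ∉ K', φ x = 0 := by
  obtain ⟨δ, hδ, hsub⟩ := hK.exists_cthickening_subset_open hU hKU
  refine ⟨fun x => (thickenedIndicator hδ K x : ℝ), _, Metric.cthickening δ K,
    (lipschitzWith_thickenedIndicator hδ K), fun x => NNReal.coe_nonneg _, fun x => ?_,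
    fun x hx => ?_, hK.cthickening, hsub, fun x hx => ?_⟩
  · exact_mod_cast thickenedIndicator_le_one hδ K x
  · show (thickenedIndicator hδ K x : ℝ) = 1
    exact_mod_cast thickenedIndicator_one hδ K hx
  · have : x ∉ Metric.thickening δ K := fun h => hx (Metric.thickening_subset_cthickening δ K h)
    show (thickenedIndicator hδ K x : ℝ) = 0
    exact_mod_cast thickenedIndicator_zero hδ K this

end LocallyLipschitz

/-! ### Localization of the variation -/

section Localization

variable {X : Type*} [MetricSpace X]

/-- Leibniz rule for a finite partition of unity: since `∑ φ j` is constant near `x`, the functions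
`u j` may be compared with an arbitrary constant `c`. -/
theorem slope_sum_mul_le {ι : Type*} (s : Finset ι) {φ u : ι → X → ℝ} {x : X} (c : ℝ)
    (hsum : ∀ᶠ y in 𝓝 x, ∑ j ∈ s, φ j y = 1) (hφ0 : ∀ j ∈ s, 0 ≤ φ j x)
    (hφ : ∀ j ∈ s, slope (φ j) x ≠ ∞) (hu : ∀ j ∈ s, slope (u j) x ≠ ∞) :
    slope (fun y => ∑ j ∈ s, φ j y * u j y) x
      ≤ ∑ j ∈ s, (ENNReal.ofReal (φ j x) * slope (u j) x
          + ENNReal.ofReal |u j x - c| * slope (φ j) x) := by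
  have h1 : (fun y => (∑ j ∈ s, φ j y * u j y) - c) =ᶠ[𝓝 x]
      fun y => ∑ j ∈ s, φ j y * (u j y - c) := by
    filter_upwards [hsum] with y hy
    simp only [mul_sub, Finset.sum_sub_distrib, ← Finset.sum_mul, hy, one_mul]
  rw [← slope_sub_const _ c, slope_congr h1]
  refine (slope_sum_le s _ x).trans (Finset.sum_le_sum fun j hj => ?_)
  have h2 := slope_mul_le (hφ j hj) (v := fun y => u j y - c) (x := x)
    (by rw [slope_sub_const]; exact hu j hj)
  rwa [slope_sub_const, abs_of_nonneg (hφ0 j hj)] at h2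

/-- Gluing a locally Lipschitz function on `U` to a Lipschitz function outside a compact
subset `K` of `U`. -/
theorem exists_lipschitz_glue [ProperSpace X] {K U : Set X} (hK : IsCompact K) (hU : IsOpen U)
    (hKU : K ⊆ U) {g : X → ℝ} (hg : ∃ L : ℝ≥0, LipschitzWith L g) :
    ∃ L : ℝ≥0, ∀ u : X → ℝ, LocallyLipschitzOn U u → ∃ w : X → ℝ, (∃ L : ℝ≥0, LipschitzWith L w) ∧
      (∀ x, |w x - g x| ≤ U.indicator (fun y => |u y - g y|) x) ∧
      ∀ x, slope w x ≤ Kᶜ.indicator (slope g) x +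
        (U.indicator (slope u) x + U.indicator (fun y => L * ENNReal.ofReal |u y - g y|) x) := by
  obtain ⟨φ, L, K', hφL, hφ0, hφ1, hφK, hK', hK'U, hφK'⟩ := exists_lipschitz_cutoff hK hU hKU
  obtain ⟨Lg, hLg⟩ := hg
  refine ⟨L, fun u hu => ?_⟩
  set v : X → ℝ := fun x => φ x * (u x + (-1) * g x) with hv
  have hv0 : ∀ x ∉ K', v x = 0 := fun x hx => by simp [hv, hφK' x hx]
  have hvU : LocallyLipschitzOn U v :=
    hφL.locallyLipschitz.locallyLipschitzOn.mul_real (hu.add_real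
      ((locallyLipschitzOn_const U (-1)).mul_real hLg.locallyLipschitz.locallyLipschitzOn))
  have hvloc : LocallyLipschitz v := by
    rw [← locallyLipschitzOn_univ]
    refine locallyLipschitzOn_of_eventuallyEq fun x _ => ?_
    by_cases hx : x ∈ K'
    · exact ⟨v, U, hU, hK'U hx, hvU, EventuallyEq.rfl⟩
    · refine ⟨fun _ => 0, K'ᶜ, hK'.isClosed.isOpen_compl, hx, locallyLipschitzOn_const _ 0, ?_⟩
      filter_upwards [hK'.isClosed.isOpen_compl.mem_nhds hx] with y hy using hv0 y hy
  obtain ⟨Lv, hLv⟩ := exists_lipschitzWith_of_eq_zero_off_compact hvloc hK' hv0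
  refine ⟨fun x => g x + v x, ⟨Lg + Lv, hLg.add hLv⟩, fun x => ?_, fun x => ?_⟩
  · by_cases hx : x ∈ U
    · simp only [hx, indicator_of_mem, add_sub_cancel_left, hv, abs_mul]
      rw [abs_of_nonneg (hφ0 x), neg_one_mul, ← sub_eq_add_neg]
      exact mul_le_of_le_one_left (abs_nonneg _) (hφ1 x)
    · simp [hx, hv0 x (fun h => hx (hK'U h))]
  · by_cases hx : x ∈ U
    · have hφs : slope φ x ≠ ∞ :=
        ((slope_le_of_lipschitz hφL x).trans_lt ENNReal.coe_lt_top).ne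
      have hgs : slope g x ≠ ∞ :=
        ((slope_le_of_lipschitz hLg x).trans_lt ENNReal.coe_lt_top).ne
      have hus : slope u x ≠ ∞ := slope_ne_top_of_locallyLipschitzOn hU hu hx
      have hφ' : LipschitzWith L fun y => 1 - φ y := by
        simpa using (LipschitzWith.const (1 : ℝ)).sub hφL
      have key := slope_sum_mul_le (Finset.univ : Finset (Fin 2)) (φ := ![φ, fun y => 1 - φ y])
        (u := ![u, g]) (x := x) (g x) (Eventually.of_forall fun y => by simp)
        (by simp [Fin.forall_fin_two, hφ0 x, hφ1 x])
        (by simpa [Fin.forall_fin_two, hφs] using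
          ((slope_le_of_lipschitz hφ' x).trans_lt ENNReal.coe_lt_top).ne)
        (by simp [Fin.forall_fin_two, hus, hgs])
      have hw : (fun x => g x + v x) =
          fun y => ∑ j : Fin 2, (![φ, fun y => 1 - φ y] j y) * (![u, g] j y) := by
        funext y
        simp [hv]
        ring
      rw [hw]
      refine key.trans ?_
      simp only [Fin.sum_univ_two, Matrix.cons_val_zero, Matrix.cons_val_one, sub_self, abs_zero,
        ENNReal.ofReal_zero, zero_mul, add_zero, hx, indicator_of_mem]
      rw [add_comm]
      have e1 : ENNReal.ofReal (1 - φ x) * slope g x ≤ Kᶜ.indicator (slope g) x := by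
        by_cases hxK : x ∈ K
        · simp [hφK x hxK]
        · rw [indicator_of_mem (by exact hxK)]
          refine mul_le_of_le_one_left zero_le ?_
          rw [← ENNReal.ofReal_one]
          exact ENNReal.ofReal_le_ofReal (by linarith [hφ0 x])
      have e2 : ENNReal.ofReal (φ x) * slope u x ≤ slope u x := by
        refine mul_le_of_le_one_left zero_le ?_
        rw [← ENNReal.ofReal_one]
        exact ENNReal.ofReal_le_ofReal (hφ1 x)
      have e3 : ENNReal.ofReal |u x - g x| * slope φ x ≤ L * ENNReal.ofReal |u x - g x| := by
        rw [mul_comm]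
        gcongr
        exact slope_le_of_lipschitz hφL x
      gcongr
    · have hxK : x ∈ Kᶜ := fun h => hx (hKU h)
      have : (fun x => g x + v x) =ᶠ[𝓝 x] g := by
        filter_upwards [hK'.isClosed.isOpen_compl.mem_nhds fun h => hx (hK'U h)] with y hy
        rw [hv0 y hy, add_zero]
      rw [slope_congr this, indicator_of_mem hxK]
      exact le_self_add

variable [MeasurableSpace X] [BorelSpace X] {m : Measure X}

/-- Lower semicontinuity of `∫_U slope` along locally Lipschitz functions on an open set `U`, at
Lipschitz functions: on a compact subset of `U` this follows from the global statement for the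
glued functions, because the contribution of `g` outside the compact set cancels. -/
theorem VariationEqSlope.lintegral_slope_le_liminf [ProperSpace X] [IsLocallyFiniteMeasure m]
    (hreg : VariationEqSlope m) {g : X → ℝ}
    (hg : ∃ L : ℝ≥0, LipschitzWith L g) (hgi : Integrable g m) (hgs : ∫⁻ x, slope g x ∂m ≠ ∞)
    {U : Set X} (hU : IsOpen U) {u : ℕ → X → ℝ} (hu : ∀ n, LocallyLipschitzOn U (u n))
    (hlim : Tendsto (fun n => ∫⁻ x in U, ENNReal.ofReal |u n x - g x| ∂m) atTop (𝓝 0)) :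
    ∫⁻ x in U, slope g x ∂m ≤ liminf (fun n => ∫⁻ x in U, slope (u n) x ∂m) atTop := by
  have hgc : Continuous g := hg.choose_spec.continuous
  have hgm : Measurable (slope g) := measurable_slope hgc
  have key : ∀ K, IsCompact K → K ⊆ U →
      ∫⁻ x in K, slope g x ∂m ≤ liminf (fun n => ∫⁻ x in U, slope (u n) x ∂m) atTop := by
    intro K hK hKU
    obtain ⟨L, hL⟩ := exists_lipschitz_glue hK hU hKU hg
    choose w hwL hwg hws using fun n => hL (u n) (hu n)
    refine le_of_forall_gt fun c hc => ?_
    obtain ⟨c', hc', hc'c⟩ := exists_between hc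
    refine lt_of_le_of_lt ?_ hc'c
    have hfreq : ∃ᶠ n in atTop, ∫⁻ x in U, slope (u n) x ∂m < c' := frequently_lt_of_liminf_lt
      (by isBoundedDefault) hc'
    have hwlim : Tendsto (fun n => ∫⁻ x, ENNReal.ofReal |w n x - g x| ∂m) atTop (𝓝 0) := by
      refine tendsto_of_tendsto_of_tendsto_of_le_of_le tendsto_const_nhds hlim
        (fun n => zero_le) fun n => ?_
      rw [← lintegral_indicator hU.measurableSet]
      refine lintegral_mono fun x => ?_
      have := hwg n x
      by_cases hx : x ∈ U
      · simpa [hx] using ENNReal.ofReal_le_ofReal this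
      · simp only [hx, not_false_eq_true, indicator_of_notMem] at this ⊢
        simp [this]
    have htv : ∫⁻ x, slope g x ∂m ≤ liminf (fun n => ∫⁻ x, slope (w n) x ∂m) atTop := by
      rw [← hreg g hg hgi]
      exact iInf₂_le_of_le w hwL (iInf_le _ hwlim)
    have hLlim : Tendsto (fun n => ∫⁻ x in U, L * ENNReal.ofReal |u n x - g x| ∂m) atTop (𝓝 0) := by
      have := ENNReal.Tendsto.const_mul (a := (L : ℝ≥0∞)) hlim (Or.inr ENNReal.coe_ne_top)
      rw [mul_zero] at this
      refine this.congr fun n => ?_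
      rw [lintegral_const_mul' _ _ ENNReal.coe_ne_top]
    have hbound : ∀ n, ∫⁻ x, slope (w n) x ∂m ≤ ∫⁻ x in Kᶜ, slope g x ∂m +
        (∫⁻ x in U, slope (u n) x ∂m + ∫⁻ x in U, L * ENNReal.ofReal |u n x - g x| ∂m) := by
      intro n
      have mU := (measurable_indicator_slope hU (hu n).continuousOn)
      rw [← lintegral_indicator hU.measurableSet, ← lintegral_indicator hU.measurableSet,
        ← lintegral_indicator hK.measurableSet.compl, ← lintegral_add_left mU,
        ← lintegral_add_left (hgm.indicator hK.measurableSet.compl)]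
      exact lintegral_mono (hws n)
    have hfin : ∫⁻ x in Kᶜ, slope g x ∂m ≠ ∞ :=
      ne_top_of_le_ne_top hgs (setLIntegral_le_lintegral _ _)
    refine ENNReal.le_of_forall_pos_le_add fun ε hε hc'' => ?_
    have hev : ∀ᶠ n in atTop, ∫⁻ x in U, L * ENNReal.ofReal |u n x - g x| ∂m < ε :=
      hLlim.eventually_lt_const (by exact_mod_cast hε)
    have h1 : ∫⁻ x, slope g x ∂m ≤ ∫⁻ x in Kᶜ, slope g x ∂m + (c' + ε) := by
      refine htv.trans (liminf_le_of_frequently_le ((hfreq.and_eventually hev).mono ?_))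
      rintro n ⟨h1, h2⟩
      refine (hbound n).trans ?_
      gcongr
    -- the part of the energy of `g` outside `K` appears on both sides
    rw [← lintegral_add_compl _ hK.measurableSet, add_comm] at h1
    exact (ENNReal.add_le_add_iff_left hfin).1 h1
  have : IsFiniteMeasure (m.withDensity (slope g)) := isFiniteMeasure_withDensity hgs
  have h2 := hU.measure_eq_iSup_isCompact (m.withDensity (slope g))
  rw [← withDensity_apply _ hU.measurableSet, h2]
  refine iSup₂_le fun K hKU => iSup_le fun hK => ?_
  rw [withDensity_apply _ hK.measurableSet]
  exact key K hK hKU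

end Localization

section PerimeterIn

variable {X : Type*} [MetricSpace X] [MeasurableSpace X] {m : Measure X}

theorem exists_of_perimeterIn_lt {A U : Set X} {c ε : ℝ≥0∞} (h : perimeterIn m A U < c)
    (hε : 0 < ε) : ∃ u : X → ℝ, LocallyLipschitzOn U u ∧
      ∫⁻ x in U, ENNReal.ofReal |u x - A.indicator (fun _ => (1 : ℝ)) x| ∂m < ε ∧
      ∫⁻ x in U, slope u x ∂m < c := by
  simp only [perimeterIn, iInf_lt_iff] at h
  obtain ⟨u, hu, hlim, hlt⟩ := h
  obtain ⟨n, h1, h2⟩ := ((frequently_lt_of_liminf_lt (by isBoundedDefault) hlt).and_eventually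
    (hlim.eventually_lt_const hε)).exists
  exact ⟨u n, hu n, h2, h1⟩

theorem perimeterIn_le_of_forall_exists {A U : Set X} {c : ℝ≥0∞}
    (h : ∀ ε : ℝ≥0, 0 < ε → ∃ u : X → ℝ, LocallyLipschitzOn U u ∧
      ∫⁻ x in U, ENNReal.ofReal |u x - A.indicator (fun _ => (1 : ℝ)) x| ∂m ≤ ε ∧
      ∫⁻ x in U, slope u x ∂m ≤ c + ε) : perimeterIn m A U ≤ c := by
  have hpos : ∀ n : ℕ, (0 : ℝ≥0) < 1 / ((n : ℝ≥0) + 1) := fun n => by positivity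
  choose u hu h1 h2 using fun n : ℕ => h _ (hpos n)
  have hlim : Tendsto (fun n : ℕ => ((1 / ((n : ℝ≥0) + 1) : ℝ≥0) : ℝ≥0∞)) atTop (𝓝 0) := by
    exact ENNReal.tendsto_coe.2 (tendsto_one_div_add_atTop_nhds_zero_nat (𝕜 := ℝ≥0))
  refine (iInf₂_le_of_le u hu (iInf_le _ (tendsto_of_tendsto_of_tendsto_of_le_of_le
    tendsto_const_nhds hlim (fun n => zero_le) h1))).trans ?_
  refine (liminf_le_liminf (Eventually.of_forall h2)).trans ?_
  have h3 : Tendsto (fun n : ℕ => c + ((1 / ((n : ℝ≥0) + 1) : ℝ≥0) : ℝ≥0∞)) atTop (𝓝 (c + 0)) :=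
    tendsto_const_nhds.add hlim
  rw [h3.liminf_eq, add_zero]

end PerimeterIn

/-! ### The coarea formula for the perimeters of superlevel sets -/

section Band

variable {X : Type*}

/-- The truncation of `f` to the band `[s, t]` of values, shifted so that it vanishes below `s`. -/
def band (f : X → ℝ) (s t : ℝ) (x : X) : ℝ := min (f x) t - min (f x) s

theorem band_of_le {f : X → ℝ} {s t : ℝ} (hst : s ≤ t) {x : X} (h : f x ≤ s) :
    band f s t x = 0 := by
  simp [band, min_eq_left h, min_eq_left (h.trans hst)]

theorem band_of_ge {f : X → ℝ} {s t : ℝ} (hst : s ≤ t) {x : X} (h : t ≤ f x) :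
    band f s t x = t - s := by
  simp [band, min_eq_right h, min_eq_right (hst.trans h)]

theorem band_of_mem {f : X → ℝ} {s t : ℝ} {x : X} (h : f x ∈ Icc s t) :
    band f s t x = f x - s := by
  simp [band, min_eq_left h.2, min_eq_right h.1]

theorem band_nonneg {f : X → ℝ} {s t : ℝ} (hst : s ≤ t) (x : X) : 0 ≤ band f s t x :=
  sub_nonneg.2 (min_le_min_left _ hst)

theorem band_le {f : X → ℝ} {s t : ℝ} (hst : s ≤ t) (x : X) : band f s t x ≤ t - s := by
  rcases le_total (f x) s with h | h
  · rw [band_of_le hst h]; linarith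
  rcases le_total (f x) t with h' | h'
  · rw [band_of_mem ⟨h, h'⟩]; linarith
  · rw [band_of_ge hst h']

theorem abs_band_sub_band_le {f : X → ℝ} {s t : ℝ} (hst : s ≤ t) (x y : X) :
    |band f s t y - band f s t x| ≤ |f y - f x| := by
  have key : ∀ x, band f s t x = max s (min (f x) t) - s := by
    intro x
    rcases le_total (f x) s with h | h
    · rw [band_of_le hst h, min_eq_left (h.trans hst), max_eq_left h, sub_self]
    rcases le_total (f x) t with h' | h'
    · rw [band_of_mem ⟨h, h'⟩, min_eq_left h', max_eq_right h]
    · rw [band_of_ge hst h', min_eq_right h', max_eq_right hst]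
  rw [key, key, sub_sub_sub_cancel_right]
  refine (abs_max_sub_max_le_max _ _ _ _).trans ?_
  rw [sub_self, abs_zero, max_eq_right (abs_nonneg _)]
  refine (abs_min_sub_min_le_max _ _ _ _).trans ?_
  rw [sub_self, abs_zero, max_eq_left (abs_nonneg _)]

variable {f : X → ℝ} {a : ℝ}

/-- Lipschitz approximation of the characteristic function of `{t ≤ f}`, rising from `0` to `1`
between the levels `t - (t - a) / (n + 2)` and `t`. -/
noncomputable def levelApprox (f : X → ℝ) (a t : ℝ) (n : ℕ) (x : X) : ℝ :=
  ((n + 2) / (t - a)) * band f (t - (t - a) / (n + 2)) t x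

theorem div_add_two_pos {t : ℝ} (hat : a < t) (n : ℕ) : 0 < (t - a) / (n + 2) :=
  div_pos (sub_pos.2 hat) (by positivity)

theorem lt_sub_div_add_two {t : ℝ} (hat : a < t) (n : ℕ) : a < t - (t - a) / (n + 2) := by
  have h : (t - a) / (n + 2) < t - a := div_lt_self (sub_pos.2 hat) (by linarith [n.cast_nonneg (α := ℝ)])
  linarith

theorem abs_levelApprox_sub_indicator_le {t : ℝ} (hat : a < t) (n : ℕ) (x : X) :
    |levelApprox f a t n x - {x | t ≤ f x}.indicator (fun _ => (1 : ℝ)) x|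
      ≤ (f ⁻¹' Ioo (t - (t - a) / (n + 2)) t).indicator (fun _ => 1) x := by
  have hp := div_add_two_pos hat n
  have hta := sub_pos.2 hat
  have hle : t - (t - a) / (n + 2) ≤ t := by linarith
  have hprod : ((n + 2) / (t - a)) * ((t - a) / (n + 2)) = 1 := by field_simp
  by_cases h1 : t ≤ f x
  · have e : levelApprox f a t n x = 1 := by
      rw [levelApprox, band_of_ge hle h1, sub_sub_cancel, hprod]
    rw [e, indicator_of_mem (by exact h1), sub_self, abs_zero]
    exact indicator_nonneg (fun _ _ => zero_le_one) x
  · rw [indicator_of_notMem (by exact h1), sub_zero]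
    by_cases h2 : f x ≤ t - (t - a) / (n + 2)
    · rw [levelApprox, band_of_le hle h2, mul_zero, abs_zero]
      exact indicator_nonneg (fun _ _ => zero_le_one) x
    · rw [indicator_of_mem (by exact ⟨not_le.1 h2, not_le.1 h1⟩), levelApprox,
        abs_of_nonneg (mul_nonneg (by positivity) (band_nonneg hle x)), ← hprod]
      gcongr
      exact (band_le hle x).trans (by linarith)

variable [MetricSpace X]

theorem exists_lipschitzWith_band {f : X → ℝ} (hf : ∃ K : ℝ≥0, LipschitzWith K f) (s t : ℝ) :
    ∃ K : ℝ≥0, LipschitzWith K (band f s t) :=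
  ⟨_, (hf.choose_spec.min_const t).sub (hf.choose_spec.min_const s)⟩

theorem exists_lipschitzWith_levelApprox (hf : ∃ K : ℝ≥0, LipschitzWith K f) (t : ℝ) (n : ℕ) :
    ∃ K : ℝ≥0, LipschitzWith K (levelApprox f a t n) := by
  obtain ⟨K, hK⟩ := exists_lipschitzWith_band hf (t - (t - a) / (n + 2)) t
  exact ⟨_, (lipschitzWith_smul ((n + 2) / (t - a))).comp hK⟩

theorem slope_band_le {f : X → ℝ} (hf : Continuous f) {s t : ℝ} (hst : s ≤ t) (x : X) :
    slope (band f s t) x ≤ (f ⁻¹' Icc s t).indicator (slope f) x := by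
  by_cases hx : f x ∈ Icc s t
  · rw [indicator_of_mem (by exact hx)]
    exact slope_le_of_abs_sub_le fun y => abs_band_sub_band_le hst x y
  · rw [indicator_of_notMem (by exact hx), nonpos_iff_eq_zero]
    rcases lt_or_ge (f x) s with h | h
    · refine slope_eq_zero_of_eventually_eq_const (c := 0) ?_
      filter_upwards [hf.continuousAt.eventually_lt_const h] with y hy using band_of_le hst hy.le
    · have h' : t < f x := lt_of_not_ge fun h' => hx ⟨h, h'⟩
      refine slope_eq_zero_of_eventually_eq_const (c := t - s) ?_
      filter_upwards [hf.continuousAt.eventually_const_lt h'] with y hy using band_of_ge hst hy.le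

theorem slope_band_of_mem {f : X → ℝ} (hf : Continuous f) {s t : ℝ} {x : X}
    (hx : f x ∈ Ioo s t) : slope (band f s t) x = slope f x := by
  rw [← slope_sub_const f s]
  refine slope_congr ?_
  filter_upwards [hf.continuousAt.eventually_const_lt hx.1, hf.continuousAt.eventually_lt_const hx.2]
    with y h1 h2 using band_of_mem ⟨h1.le, h2.le⟩

end Band

section Coarea

variable {X : Type*} [MetricSpace X] [MeasurableSpace X]

/-- The measure `slope f • m` on the superlevel set `{a < f}`. -/
noncomputable def slopeMeasure (m : Measure X) (f : X → ℝ) (a : ℝ) : Measure X :=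
  (m.withDensity (slope f)).restrict (f ⁻¹' Ioi a)

/-- The distribution of the values of `f` under `slope f • m` on `U ∩ {a < f}`. By the coarea formula
its density at `t` is the perimeter of `{t ≤ f}` in `U`. -/
noncomputable def levelMeasure (m : Measure X) (f : X → ℝ) (a : ℝ) (U : Set X) : Measure ℝ :=
  ((slopeMeasure m f a).restrict U).map f

variable [BorelSpace X] {m : Measure X} {f : X → ℝ} {a : ℝ}

theorem levelMeasure_apply (hf : Continuous f) {U : Set X} {J : Set ℝ}
    (hJ : MeasurableSet J) : levelMeasure m f a U J = slopeMeasure m f a (U ∩ f ⁻¹' J) := by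
  rw [levelMeasure, Measure.map_apply hf.measurable hJ, Measure.restrict_apply (hf.measurable hJ),
    inter_comm]

theorem slopeMeasure_apply (hf : Continuous f) {B : Set X} (hB : MeasurableSet B) :
    slopeMeasure m f a B = ∫⁻ x in B ∩ f ⁻¹' Ioi a, slope f x ∂m := by
  rw [slopeMeasure, Measure.restrict_apply hB, withDensity_apply _
    (hB.inter (hf.measurable measurableSet_Ioi))]

theorem isFiniteMeasure_slopeMeasure (hf : ∃ K : ℝ≥0, LipschitzWith K f)
    (hfin : m (f ⁻¹' Ioi a) < ∞) : IsFiniteMeasure (slopeMeasure m f a) := by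
  obtain ⟨K, hK⟩ := hf
  refine ⟨?_⟩
  rw [slopeMeasure_apply hK.continuous MeasurableSet.univ, univ_inter]
  calc ∫⁻ x in f ⁻¹' Ioi a, slope f x ∂m ≤ ∫⁻ x in f ⁻¹' Ioi a, (K : ℝ≥0∞) ∂m :=
        lintegral_mono fun x => slope_le_of_lipschitz hK x
    _ = K * m (f ⁻¹' Ioi a) := by rw [setLIntegral_const]
    _ < ∞ := ENNReal.mul_lt_top ENNReal.coe_lt_top hfin

theorem integrable_band (hf : Continuous f) {s t : ℝ} (hst : s ≤ t)
    (hfin : m (f ⁻¹' Ioi s) < ∞) : Integrable (band f s t) m := by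
  have hc : Continuous (band f s t) := by unfold band; fun_prop
  have hms : MeasurableSet (f ⁻¹' Ioi s) := hf.measurable measurableSet_Ioi
  have h1 : Integrable ((f ⁻¹' Ioi s).indicator fun _ => t - s) m :=
    (integrable_indicator_iff hms).2 (integrableOn_const hfin.ne)
  refine h1.mono' hc.measurable.aestronglyMeasurable (Eventually.of_forall fun x => ?_)
  rw [Real.norm_of_nonneg (band_nonneg hst x)]
  by_cases hx : s < f x
  · rw [indicator_of_mem (by exact hx)]
    exact band_le hst x
  · rw [indicator_of_notMem (by exact hx), band_of_le hst (not_lt.1 hx)]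

theorem tendsto_levelApprox (hf : Continuous f) (hfin : m (f ⁻¹' Ioi a) < ∞) {t : ℝ}
    (hat : a < t) : Tendsto (fun n => ∫⁻ x, ENNReal.ofReal
      |levelApprox f a t n x - {x | t ≤ f x}.indicator (fun _ => (1 : ℝ)) x| ∂m) atTop (𝓝 0) := by
  have hm1 : ∀ n : ℕ, Measurable
      ((f ⁻¹' Ioo (t - (t - a) / (n + 2)) t).indicator fun _ => (1 : ℝ≥0∞)) := fun n =>
    measurable_const.indicator (hf.measurable measurableSet_Ioo)
  have hlim : Tendsto (fun n : ℕ => ∫⁻ x,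
      (f ⁻¹' Ioo (t - (t - a) / (n + 2)) t).indicator (fun _ => (1 : ℝ≥0∞)) x ∂m) atTop
      (𝓝 (∫⁻ _, 0 ∂m)) := by
    refine tendsto_lintegral_of_dominated_convergence
      ((f ⁻¹' Ioi a).indicator fun _ => (1 : ℝ≥0∞)) hm1 (fun n => Eventually.of_forall fun x => ?_)
      ?_ (Eventually.of_forall fun x => ?_)
    · refine indicator_le_indicator_of_subset (fun y hy => ?_) (fun _ => zero_le) x
      exact (lt_sub_div_add_two hat n).trans hy.1
    · rw [lintegral_indicator_const (hf.measurable measurableSet_Ioi), one_mul]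
      exact hfin.ne
    · refine tendsto_const_nhds.congr' ?_
      by_cases hx : t ≤ f x
      · exact Eventually.of_forall fun n =>
          (indicator_of_notMem (fun h => (not_lt.2 hx) h.2) _).symm
      · have h1 : Tendsto (fun n : ℕ => t - (t - a) / (n + 2)) atTop (𝓝 (t - 0)) := by
          refine tendsto_const_nhds.sub (tendsto_const_nhds.div_atTop ?_)
          exact tendsto_atTop_add_const_right _ _ tendsto_natCast_atTop_atTop
        rw [sub_zero] at h1
        filter_upwards [h1.eventually_const_lt (not_le.1 hx)] with n hn
        exact (indicator_of_notMem (fun h => (not_lt.2 hn.le) h.1) _).symm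
  rw [lintegral_zero] at hlim
  refine tendsto_of_tendsto_of_tendsto_of_le_of_le tendsto_const_nhds hlim (fun n => zero_le)
    fun n => lintegral_mono fun x => ?_
  refine (ENNReal.ofReal_le_ofReal (abs_levelApprox_sub_indicator_le hat n x)).trans ?_
  by_cases hx : x ∈ f ⁻¹' Ioo (t - (t - a) / (n + 2)) t <;> simp [hx]

theorem lintegral_slope_levelApprox_le (hf : ∃ K : ℝ≥0, LipschitzWith K f) {t : ℝ} (hat : a < t)
    (n : ℕ) {B : Set X} (hB : MeasurableSet B) :
    ∫⁻ x in B, slope (levelApprox f a t n) x ∂m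
      ≤ levelMeasure m f a B (Icc (t - (t - a) / (n + 2)) t) /
        volume (Icc (t - (t - a) / (n + 2)) t) := by
  have hc : Continuous f := hf.choose_spec.continuous
  have hp := div_add_two_pos hat n
  have hta := sub_pos.2 hat
  have hle : t - (t - a) / (n + 2) ≤ t := by linarith
  rw [levelMeasure_apply hc measurableSet_Icc, slopeMeasure_apply hc
    (hB.inter (hc.measurable measurableSet_Icc)), Real.volume_Icc, sub_sub_cancel,
    ENNReal.div_eq_inv_mul, ← ENNReal.ofReal_inv_of_pos hp, inv_div]
  have hsub : B ∩ f ⁻¹' Icc (t - (t - a) / (n + 2)) t ∩ f ⁻¹' Ioi a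
      = f ⁻¹' Icc (t - (t - a) / (n + 2)) t ∩ B := by
    ext x
    simp only [mem_inter_iff, mem_preimage, mem_Icc, mem_Ioi]
    constructor
    · rintro ⟨⟨h1, h2⟩, -⟩; exact ⟨h2, h1⟩
    · rintro ⟨h1, h2⟩; exact ⟨⟨h2, h1⟩, (lt_sub_div_add_two hat n).trans_le h1.1⟩
  rw [hsub, ← Measure.restrict_restrict (hc.measurable measurableSet_Icc),
    ← lintegral_indicator (hc.measurable measurableSet_Icc),
    ← lintegral_const_mul' _ _ ENNReal.ofReal_ne_top]
  refine lintegral_mono fun x => ?_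
  obtain ⟨K, hK⟩ := exists_lipschitzWith_band hf (t - (t - a) / (n + 2)) t
  refine (slope_const_mul_le _ ((slope_le_of_lipschitz hK x).trans_lt
    ENNReal.coe_lt_top).ne).trans ?_
  rw [abs_of_nonneg (by positivity)]
  gcongr
  exact slope_band_le hc hle x

theorem ae_tendsto_levelMeasure_div (ρ : Measure ℝ) [IsFiniteMeasure ρ] (a : ℝ) :
    ∀ᵐ t : ℝ, a < t → Tendsto (fun n : ℕ => ρ (Icc (t - (t - a) / (n + 2)) t) /
        volume (Icc (t - (t - a) / (n + 2)) t)) atTop (𝓝 (ρ.rnDeriv volume t)) := by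
  filter_upwards [VitaliFamily.ae_tendsto_rnDeriv
    (IsUnifLocDoublingMeasure.vitaliFamily (volume : Measure ℝ) 1) ρ] with t ht hat
  refine (ht.comp (Real.tendsto_Icc_vitaliFamily_left t)).comp
    (tendsto_nhdsWithin_iff.2 ⟨?_, Eventually.of_forall fun n => ?_⟩)
  · have h1 : Tendsto (fun n : ℕ => t - (t - a) / (n + 2)) atTop (𝓝 (t - 0)) := by
      refine tendsto_const_nhds.sub (tendsto_const_nhds.div_atTop ?_)
      exact tendsto_atTop_add_const_right _ _ tendsto_natCast_atTop_atTop
    rwa [sub_zero] at h1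
  · exact sub_lt_self _ (div_add_two_pos hat n)

theorem isFiniteMeasure_levelMeasure (hf : ∃ K : ℝ≥0, LipschitzWith K f)
    (hfin : m (f ⁻¹' Ioi a) < ∞) (U : Set X) : IsFiniteMeasure (levelMeasure m f a U) := by
  have := isFiniteMeasure_slopeMeasure hf hfin
  exact Measure.isFiniteMeasure_map _ _

theorem perimeterIn_le_liminf_levelApprox (hf : ∃ K : ℝ≥0, LipschitzWith K f)
    (hfin : m (f ⁻¹' Ioi a) < ∞) {t : ℝ} (hat : a < t) (U : Set X) :
    perimeterIn m {x | t ≤ f x} U ≤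
      liminf (fun n => ∫⁻ x in U, slope (levelApprox f a t n) x ∂m) atTop := by
  refine iInf₂_le_of_le (levelApprox f a t) (fun n => ?_) (iInf_le _ ?_)
  · exact (exists_lipschitzWith_levelApprox hf t n).choose_spec.locallyLipschitz.locallyLipschitzOn
  · refine tendsto_of_tendsto_of_tendsto_of_le_of_le tendsto_const_nhds
      (tendsto_levelApprox hf.choose_spec.continuous hfin hat) (fun n => zero_le) fun n => ?_
    exact setLIntegral_le_lintegral _ _

theorem ae_perimeterIn_le_rnDeriv (hf : ∃ K : ℝ≥0, LipschitzWith K f)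
    (hfin : m (f ⁻¹' Ioi a) < ∞) {U : Set X} (hU : IsOpen U) :
    ∀ᵐ t : ℝ, a < t →
      perimeterIn m {x | t ≤ f x} U ≤ (levelMeasure m f a U).rnDeriv volume t := by
  have := isFiniteMeasure_levelMeasure hf hfin U
  filter_upwards [ae_tendsto_levelMeasure_div (levelMeasure m f a U) a] with t ht hat
  rw [← (ht hat).liminf_eq]
  exact (perimeterIn_le_liminf_levelApprox hf hfin hat U).trans (liminf_le_liminf
    (Eventually.of_forall fun n => lintegral_slope_levelApprox_le hf hat n hU.measurableSet))

end Coarea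

section CoareaLower

variable {X : Type*} [MetricSpace X] [MeasurableSpace X] [BorelSpace X] {m : Measure X}
  {f : X → ℝ} {a : ℝ}

/-- On an interval `(s, t)` of levels some level set has perimeter close to the infimum, and a
locally Lipschitz approximation of its characteristic function, scaled by `t - s`, is close to the
truncation of `f` to the band. -/
theorem exists_approx_band (hf : Continuous f) {U : Set X} (hU : IsOpen U) {s t : ℝ} (hst : s < t)
    (hp : ∫⁻ r in Ioo s t, perimeterIn m {x | r ≤ f x} U ≠ ∞) {ε : ℝ≥0∞} (hε : 0 < ε) :
    ∃ u : X → ℝ, LocallyLipschitzOn U u ∧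
      ∫⁻ x in U, ENNReal.ofReal |u x - band f s t x| ∂m
        ≤ ENNReal.ofReal (t - s) * (ε + m (f ⁻¹' Ioo s t)) ∧
      ∫⁻ x in U, slope u x ∂m ≤
        (∫⁻ r in Ioo s t, perimeterIn m {x | r ≤ f x} U) + ENNReal.ofReal (t - s) * ε := by
  set p : ℝ → ℝ≥0∞ := fun r => perimeterIn m {x | r ≤ f x} U with hpdef
  -- bounding the mean value by the infimum avoids any measurability of `p`
  set c : ℝ≥0∞ := ⨅ r ∈ Ioo s t, p r with hc
  have hts : 0 < t - s := sub_pos.2 hst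
  have hcp : ENNReal.ofReal (t - s) * c ≤ ∫⁻ r in Ioo s t, p r := by
    rw [← Real.volume_Ioo, mul_comm, ← setLIntegral_const]
    exact setLIntegral_mono' measurableSet_Ioo fun r hr => iInf₂_le r hr
  have hctop : c ≠ ∞ := by
    intro h
    rw [h, ENNReal.mul_top (by simpa using hst)] at hcp
    exact hp (top_le_iff.1 hcp)
  obtain ⟨r, hr, hrc⟩ : ∃ r ∈ Ioo s t, p r < c + ε := by
    have : c < c + ε := ENNReal.lt_add_right hctop hε.ne'
    simpa only [hc, iInf_lt_iff, exists_prop] using this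
  obtain ⟨v, hv, hvχ, hvs⟩ := exists_of_perimeterIn_lt hrc hε
  refine ⟨fun x => (t - s) * v x, (locallyLipschitzOn_const U _).mul_real hv, ?_, ?_⟩
  · have hmeas : Measurable ((f ⁻¹' Ioo s t).indicator fun _ => (1 : ℝ≥0∞)) :=
      measurable_const.indicator (hf.measurable measurableSet_Ioo)
    have hpt : ∀ x, ENNReal.ofReal |(t - s) * v x - band f s t x| ≤ ENNReal.ofReal (t - s) *
        (ENNReal.ofReal |v x - {x | r ≤ f x}.indicator (fun _ => (1 : ℝ)) x| +
          (f ⁻¹' Ioo s t).indicator (fun _ => 1) x) := by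
      intro x
      have h1 : |(t - s) * {x | r ≤ f x}.indicator (fun _ => (1 : ℝ)) x - band f s t x|
          ≤ (t - s) * (f ⁻¹' Ioo s t).indicator (fun _ => 1) x := by
        rcases le_or_gt (f x) s with h | h
        · have : ¬ r ≤ f x := not_le.2 (h.trans_lt hr.1)
          rw [band_of_le hst.le h, indicator_of_notMem (by exact this)]
          simp only [mul_zero, sub_zero, abs_zero]
          exact mul_nonneg hts.le (indicator_nonneg (fun _ _ => zero_le_one) x)
        rcases le_or_gt t (f x) with h' | h'
        · have : r ≤ f x := hr.2.le.trans h'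
          rw [band_of_ge hst.le h', indicator_of_mem (by exact this), mul_one, sub_self, abs_zero]
          exact mul_nonneg hts.le (indicator_nonneg (fun _ _ => zero_le_one) x)
        · rw [indicator_of_mem (s := f ⁻¹' Ioo s t) (by exact ⟨h, h'⟩), mul_one]
          have h0 := band_nonneg (f := f) hst.le x
          have h2 := band_le (f := f) hst.le x
          by_cases hx : r ≤ f x
          · rw [indicator_of_mem (by exact hx), mul_one, abs_of_nonneg (by linarith)]
            linarith
          · rw [indicator_of_notMem (by exact hx), mul_zero, zero_sub, abs_neg, abs_of_nonneg h0]
            exact h2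
      have h2 : |(t - s) * v x - band f s t x| ≤
          (t - s) * (|v x - {x | r ≤ f x}.indicator (fun _ => (1 : ℝ)) x| +
            (f ⁻¹' Ioo s t).indicator (fun _ => 1) x) := by
        rw [mul_add]
        refine (abs_sub_le _ ((t - s) * {x | r ≤ f x}.indicator (fun _ => (1 : ℝ)) x) _).trans
          (add_le_add ?_ h1)
        rw [← mul_sub, abs_mul, abs_of_pos hts]
      refine (ENNReal.ofReal_le_ofReal h2).trans ?_
      rw [ENNReal.ofReal_mul hts.le, ENNReal.ofReal_add (abs_nonneg _)
        (indicator_nonneg (fun _ _ => zero_le_one) x)]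
      by_cases hx : x ∈ f ⁻¹' Ioo s t <;> simp [hx]
    refine (lintegral_mono hpt).trans ?_
    rw [lintegral_const_mul' _ _ ENNReal.ofReal_ne_top, lintegral_add_right _ hmeas]
    gcongr
    rw [lintegral_indicator_const (hf.measurable measurableSet_Ioo), one_mul]
    exact Measure.restrict_apply_le _ _
  · calc ∫⁻ x in U, slope (fun x => (t - s) * v x) x ∂m
        ≤ ∫⁻ x in U, ENNReal.ofReal (t - s) * slope v x ∂m := by
          refine setLIntegral_mono' hU.measurableSet fun x hx => ?_
          refine (slope_const_mul_le _ (slope_ne_top_of_locallyLipschitzOn hU hv hx)).trans ?_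
          rw [abs_of_pos hts]
      _ = ENNReal.ofReal (t - s) * ∫⁻ x in U, slope v x ∂m :=
          lintegral_const_mul' _ _ ENNReal.ofReal_ne_top
      _ ≤ ENNReal.ofReal (t - s) * (c + ε) := by gcongr
      _ ≤ _ := by rw [mul_add]; gcongr

/-- Splitting `(a, b)` into `N + 1` bands. -/
theorem exists_approx_band_partition (hf : Continuous f) {U : Set X} (hU : IsOpen U) {b : ℝ}
    (hab : a < b) (hp : ∫⁻ r in Ioo a b, perimeterIn m {x | r ≤ f x} U ≠ ∞) {ε : ℝ≥0∞} (hε : 0 < ε)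
    (N : ℕ) :
    ∃ u : X → ℝ, LocallyLipschitzOn U u ∧
      ∫⁻ x in U, ENNReal.ofReal |u x - band f a b x| ∂m
        ≤ ENNReal.ofReal (b - a) * ε + ENNReal.ofReal ((b - a) / (N + 1)) * m (f ⁻¹' Ioi a) ∧
      ∫⁻ x in U, slope u x ∂m ≤
        (∫⁻ r in Ioo a b, perimeterIn m {x | r ≤ f x} U) + ENNReal.ofReal (b - a) * ε := by
  set p : ℝ → ℝ≥0∞ := fun r => perimeterIn m {x | r ≤ f x} U with hpdef
  set h : ℝ := (b - a) / (N + 1) with hh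
  have hN : (0 : ℝ) < N + 1 := by positivity
  have hba : 0 < b - a := sub_pos.2 hab
  have h0 : 0 < h := div_pos hba hN
  set s : ℕ → ℝ := fun i => a + i * h with hs
  have hsmono : Monotone s := fun i j hij => by
    simp only [hs]
    gcongr
  have hsucc : ∀ i, s (i + 1) - s i = h := fun i => by simp only [hs]; push_cast; ring
  have hs0 : s 0 = a := by simp [hs]
  have hsN : s (N + 1) = b := by simp only [hs, hh]; push_cast; field_simp; ring
  have hlt : ∀ i, s i < s (i + 1) := fun i => by linarith [hsucc i]
  have hdisj : Pairwise (Function.onFun Disjoint fun i => Ioo (s i) (s (i + 1))) :=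
    hsmono.pairwise_disjoint_on_Ioo_succ
  have hsub : ∀ i ∈ Finset.range (N + 1), Ioo (s i) (s (i + 1)) ⊆ Ioo a b := fun i hi => by
    refine Ioo_subset_Ioo ?_ ?_
    · rw [← hs0]; exact hsmono (Nat.zero_le i)
    · rw [← hsN]; exact hsmono (Finset.mem_range.1 hi)
  have hpi : ∑ i ∈ Finset.range (N + 1), ∫⁻ r in Ioo (s i) (s (i + 1)), p r ≤
      ∫⁻ r in Ioo a b, p r := by
    rw [← lintegral_biUnion_finset (hdisj.set_pairwise _) fun i _ => measurableSet_Ioo]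
    exact lintegral_mono_set (iUnion₂_subset hsub)
  have hmi : ∑ i ∈ Finset.range (N + 1), m (f ⁻¹' Ioo (s i) (s (i + 1))) ≤ m (f ⁻¹' Ioi a) := by
    rw [← measure_biUnion_finset (fun i _ j _ hij => (hdisj hij).preimage f) fun i _ =>
      hf.measurable measurableSet_Ioo]
    exact measure_mono (iUnion₂_subset fun i hi x hx => (hsub i hi hx).1)
  have hex : ∀ i, ∃ u : X → ℝ, i ∈ Finset.range (N + 1) → LocallyLipschitzOn U u ∧
      ∫⁻ x in U, ENNReal.ofReal |u x - band f (s i) (s (i + 1)) x| ∂m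
        ≤ ENNReal.ofReal h * (ε + m (f ⁻¹' Ioo (s i) (s (i + 1)))) ∧
      ∫⁻ x in U, slope u x ∂m ≤
        (∫⁻ r in Ioo (s i) (s (i + 1)), p r) + ENNReal.ofReal h * ε := by
    intro i
    by_cases hi : i ∈ Finset.range (N + 1)
    · obtain ⟨u, hu⟩ := exists_approx_band hf hU (hlt i)
        (ne_top_of_le_ne_top hp (lintegral_mono_set (hsub i hi))) hε
      rw [hsucc] at hu
      exact ⟨u, fun _ => hu⟩
    · exact ⟨0, fun h => absurd h hi⟩
  choose u hu using hex
  have hcount : ∑ i ∈ Finset.range (N + 1), ENNReal.ofReal h * ε = ENNReal.ofReal (b - a) * ε := by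
    rw [Finset.sum_const, Finset.card_range, nsmul_eq_mul, ← mul_assoc]
    congr 1
    rw [← ENNReal.ofReal_natCast, ← ENNReal.ofReal_mul (by positivity)]
    congr 1
    rw [hh]; push_cast; field_simp
  refine ⟨fun x => ∑ i ∈ Finset.range (N + 1), u i x,
    locallyLipschitzOn_sum _ fun i hi => (hu i hi).1, ?_, ?_⟩
  · have hb : ∀ x, band f a b x = ∑ i ∈ Finset.range (N + 1), band f (s i) (s (i + 1)) x := by
      intro x
      simp only [band]
      rw [Finset.sum_range_sub (fun i => min (f x) (s i)), hs0, hsN]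
    calc ∫⁻ x in U, ENNReal.ofReal |∑ i ∈ Finset.range (N + 1), u i x - band f a b x| ∂m
        ≤ ∫⁻ x in U, ∑ i ∈ Finset.range (N + 1),
            ENNReal.ofReal |u i x - band f (s i) (s (i + 1)) x| ∂m := by
          refine lintegral_mono fun x => ?_
          rw [hb x, ← Finset.sum_sub_distrib, ← ENNReal.ofReal_sum_of_nonneg fun _ _ => abs_nonneg _]
          exact ENNReal.ofReal_le_ofReal (Finset.abs_sum_le_sum_abs _ _)
      _ = ∑ i ∈ Finset.range (N + 1), ∫⁻ x in U,
            ENNReal.ofReal |u i x - band f (s i) (s (i + 1)) x| ∂m := by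
          refine lintegral_finsetSum' _ fun i hi => ?_
          have h1 : ContinuousOn (u i) U := (hu i hi).1.continuousOn
          have h2 : Continuous (band f (s i) (s (i + 1))) := by unfold band; fun_prop
          exact ((h1.sub h2.continuousOn).aemeasurable hU.measurableSet).abs.ennreal_ofReal
      _ ≤ ∑ i ∈ Finset.range (N + 1),
            (ENNReal.ofReal h * ε + ENNReal.ofReal h * m (f ⁻¹' Ioo (s i) (s (i + 1)))) :=
          Finset.sum_le_sum fun i hi => (hu i hi).2.1.trans_eq (mul_add _ _ _)
      _ ≤ _ := by
          rw [Finset.sum_add_distrib, hcount, ← Finset.mul_sum]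
          gcongr
  · calc ∫⁻ x in U, slope (fun x => ∑ i ∈ Finset.range (N + 1), u i x) x ∂m
        ≤ ∫⁻ x in U, ∑ i ∈ Finset.range (N + 1), slope (u i) x ∂m :=
          lintegral_mono fun x => slope_sum_le _ _ x
      _ = ∑ i ∈ Finset.range (N + 1), ∫⁻ x in U, slope (u i) x ∂m :=
          lintegral_finsetSum' _ fun i hi => aemeasurable_slope_restrict hU (hu i hi).1.continuousOn
      _ ≤ ∑ i ∈ Finset.range (N + 1),
            ((∫⁻ r in Ioo (s i) (s (i + 1)), p r) + ENNReal.ofReal h * ε) :=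
          Finset.sum_le_sum fun i hi => (hu i hi).2.2
      _ ≤ _ := by
          rw [Finset.sum_add_distrib, hcount]
          gcongr

/-- One half of the coarea formula: the sums of characteristic functions approximating the
truncation of `f` are convex combinations, and the variation is lower semicontinuous. -/
theorem VariationEqSlope.levelMeasure_Ioo_le [ProperSpace X] [IsLocallyFiniteMeasure m]
    (hreg : VariationEqSlope m) (hf : ∃ K : ℝ≥0, LipschitzWith K f)
    (hfin : m (f ⁻¹' Ici a) < ∞) {U : Set X} (hU : IsOpen U) {b : ℝ} (hab : a < b) :
    levelMeasure m f a U (Ioo a b) ≤ ∫⁻ r in Ioo a b, perimeterIn m {x | r ≤ f x} U := by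
  by_cases hp : ∫⁻ r in Ioo a b, perimeterIn m {x | r ≤ f x} U = ∞
  · rw [hp]; exact le_top
  have hc : Continuous f := hf.choose_spec.continuous
  have hfin' : m (f ⁻¹' Ioi a) < ∞ := (measure_mono (preimage_mono Ioi_subset_Ici_self)).trans_lt hfin
  have hpos : ∀ N : ℕ, (0 : ℝ≥0∞) < ((1 / ((N : ℝ≥0) + 1) : ℝ≥0) : ℝ≥0∞) := fun N => by
    rw [ENNReal.coe_pos]; positivity
  have hε : Tendsto (fun n : ℕ => ((1 / ((n : ℝ≥0) + 1) : ℝ≥0) : ℝ≥0∞)) atTop (𝓝 0) :=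
    ENNReal.tendsto_coe.2 (tendsto_one_div_add_atTop_nhds_zero_nat (𝕜 := ℝ≥0))
  choose u hu hud hus using fun N : ℕ => exists_approx_band_partition hc hU hab hp (hpos N) N
  have hbd : ENNReal.ofReal (b - a) ≠ ∞ := ENNReal.ofReal_ne_top
  have hε' : Tendsto (fun n : ℕ => ENNReal.ofReal (b - a) * ((1 / ((n : ℝ≥0) + 1) : ℝ≥0) : ℝ≥0∞))
      atTop (𝓝 0) := by
    simpa using ENNReal.Tendsto.const_mul hε (Or.inr hbd)
  have hlim : Tendsto (fun n => ∫⁻ x in U, ENNReal.ofReal |u n x - band f a b x| ∂m) atTop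
      (𝓝 0) := by
    have h2 : Tendsto (fun N : ℕ => ENNReal.ofReal ((b - a) / (N + 1)) * m (f ⁻¹' Ioi a)) atTop
        (𝓝 (ENNReal.ofReal 0 * m (f ⁻¹' Ioi a))) := by
      refine ENNReal.Tendsto.mul_const (ENNReal.tendsto_ofReal ?_) (Or.inr hfin'.ne)
      exact tendsto_const_nhds.div_atTop
        (tendsto_atTop_add_const_right _ _ tendsto_natCast_atTop_atTop)
    have h3 := hε'.add h2
    simp only [ENNReal.ofReal_zero, zero_mul, add_zero] at h3
    exact tendsto_of_tendsto_of_tendsto_of_le_of_le tendsto_const_nhds h3 (fun n => zero_le) hud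
  have hbs : ∫⁻ x, slope (band f a b) x ∂m ≠ ∞ := by
    obtain ⟨K, hK⟩ := hf
    refine ne_top_of_le_ne_top (ENNReal.mul_ne_top (ENNReal.coe_ne_top (r := K)) hfin.ne) ?_
    calc ∫⁻ x, slope (band f a b) x ∂m ≤ ∫⁻ x, (f ⁻¹' Ici a).indicator (fun _ => (K : ℝ≥0∞)) x ∂m := by
          refine lintegral_mono fun x => (slope_band_le hc hab.le x).trans ?_
          refine (indicator_le_indicator (g := fun _ => (K : ℝ≥0∞))
            (slope_le_of_lipschitz hK x)).trans ?_
          exact indicator_le_indicator_of_subset (preimage_mono Icc_subset_Ici_self)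
            (fun _ => zero_le) x
      _ = K * m (f ⁻¹' Ici a) := lintegral_indicator_const (hc.measurable measurableSet_Ici) _
  have hlsc := hreg.lintegral_slope_le_liminf (exists_lipschitzWith_band hf a b)
    (integrable_band hc hab.le hfin') hbs hU hu hlim
  calc levelMeasure m f a U (Ioo a b) = ∫⁻ x in U ∩ f ⁻¹' Ioo a b, slope f x ∂m := by
        rw [levelMeasure_apply hc measurableSet_Ioo, slopeMeasure_apply hc
          (hU.measurableSet.inter (hc.measurable measurableSet_Ioo)), inter_assoc,
          ← preimage_inter, inter_eq_left.2 Ioo_subset_Ioi_self]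
    _ = ∫⁻ x in U ∩ f ⁻¹' Ioo a b, slope (band f a b) x ∂m :=
        (setLIntegral_congr_fun (hU.measurableSet.inter (hc.measurable measurableSet_Ioo))
          fun x hx => slope_band_of_mem hc hx.2).symm
    _ ≤ ∫⁻ x in U, slope (band f a b) x ∂m := lintegral_mono_set inter_subset_left
    _ ≤ _ := hlsc
    _ ≤ _ := liminf_le_liminf (Eventually.of_forall hus)
    _ = _ := by
        have h3 := (tendsto_const_nhds
          (x := ∫⁻ r in Ioo a b, perimeterIn m {x | r ≤ f x} U)).add hε'
        rw [h3.liminf_eq, add_zero]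

theorem levelMeasure_Iic (hf : Continuous f) (U : Set X) : levelMeasure m f a U (Iic a) = 0 := by
  rw [levelMeasure_apply hf measurableSet_Iic, slopeMeasure,
    Measure.restrict_apply' (hf.measurable measurableSet_Ioi), inter_assoc, ← preimage_inter]
  have : Iic a ∩ Ioi a = ∅ := by ext; simp
  rw [this, preimage_empty, inter_empty, measure_empty]

theorem VariationEqSlope.levelMeasure_univ_le [ProperSpace X] [IsLocallyFiniteMeasure m]
    (hreg : VariationEqSlope m) (hf : ∃ K : ℝ≥0, LipschitzWith K f)
    (hfin : m (f ⁻¹' Ici a) < ∞) {U : Set X} (hU : IsOpen U) :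
    levelMeasure m f a U univ ≤ ∫⁻ r in Ioi a, perimeterIn m {x | r ≤ f x} U := by
  have hc : Continuous f := hf.choose_spec.continuous
  have h1 : levelMeasure m f a U univ = levelMeasure m f a U (Ioi a) := by
    refine le_antisymm ?_ (measure_mono (subset_univ _))
    rw [← Iic_union_Ioi (a := a)]
    refine (measure_union_le _ _).trans ?_
    rw [levelMeasure_Iic hc, zero_add]
  have h2 : Ioi a = ⋃ n : ℕ, Ioo a (a + (n + 1)) := by
    ext x
    simp only [mem_Ioi, mem_iUnion, mem_Ioo]
    constructor
    · intro hx
      obtain ⟨n, hn⟩ := exists_nat_gt (x - a)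
      exact ⟨n, hx, by linarith⟩
    · rintro ⟨n, hn, -⟩; exact hn
  have hmono : Monotone fun n : ℕ => Ioo a (a + ((n : ℝ) + 1)) := fun i j hij =>
    Ioo_subset_Ioo_right (by
      have : (i : ℝ) ≤ j := by exact_mod_cast hij
      linarith)
  rw [h1]
  conv_lhs => rw [h2]
  rw [hmono.measure_iUnion]
  refine iSup_le fun n => (hreg.levelMeasure_Ioo_le hf hfin hU (by
    have := n.cast_nonneg (α := ℝ); linarith)).trans ?_
  exact lintegral_mono_set Ioo_subset_Ioi_self

/-- The coarea formula: for almost every level above `a` the perimeter in `U` is the density of the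
level measure, which is absolutely continuous. -/
theorem VariationEqSlope.coarea [ProperSpace X] [IsLocallyFiniteMeasure m]
    (hreg : VariationEqSlope m) (hf : ∃ K : ℝ≥0, LipschitzWith K f)
    (hfin : m (f ⁻¹' Ici a) < ∞) {U : Set X} (hU : IsOpen U) :
    volume.withDensity ((levelMeasure m f a U).rnDeriv volume) = levelMeasure m f a U ∧
    ∀ᵐ t : ℝ, a < t →
      perimeterIn m {x | t ≤ f x} U = (levelMeasure m f a U).rnDeriv volume t := by
  have hfin' : m (f ⁻¹' Ioi a) < ∞ := (measure_mono (preimage_mono Ioi_subset_Ici_self)).trans_lt hfin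
  have hρ := isFiniteMeasure_levelMeasure hf hfin' U
  set ρ := levelMeasure m f a U with hρdef
  set D := ρ.rnDeriv volume with hD
  have hle : volume.withDensity D ≤ ρ := Measure.withDensity_rnDeriv_le ρ volume
  have hfinD : IsFiniteMeasure (volume.withDensity D) := isFiniteMeasure_of_le ρ hle
  have hup : ∀ᵐ t ∂volume.restrict (Ioi a), perimeterIn m {x | t ≤ f x} U ≤ D t :=
    (ae_restrict_iff' measurableSet_Ioi).2 (ae_perimeterIn_le_rnDeriv hf hfin' hU)
  have h1 : ρ univ ≤ ∫⁻ r in Ioi a, perimeterIn m {x | r ≤ f x} U :=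
    hreg.levelMeasure_univ_le hf hfin hU
  have h2 : ∫⁻ r in Ioi a, perimeterIn m {x | r ≤ f x} U ≤ ∫⁻ r in Ioi a, D r :=
    lintegral_mono_ae hup
  have h3 : ∫⁻ r in Ioi a, D r ≤ ρ univ := by
    rw [← withDensity_apply _ measurableSet_Ioi]
    exact (hle _).trans (measure_mono (subset_univ _))
  refine ⟨Measure.eq_of_le_of_measure_univ_eq hle (le_antisymm (hle _) ?_), ?_⟩
  · rw [withDensity_apply _ MeasurableSet.univ]
    exact (h1.trans h2).trans (lintegral_mono_set (subset_univ _))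
  · refine (ae_restrict_iff' measurableSet_Ioi).1 ?_
    exact ae_eq_of_ae_le_of_lintegral_le hup
      (ne_top_of_le_ne_top (measure_ne_top ρ univ) (h2.trans h3))
      (Measure.measurable_rnDeriv _ _).aemeasurable (h3.trans h1)

end CoareaLower

/-! ### A coarea inequality for the spherical measure of level sets -/

section Spherical

universe u

variable {X : Type u} [MetricSpace X] [MeasurableSpace X] {m : Measure X}

theorem sphericalPre_closedBall_le {δ r : ℝ} (x : X) (hr : 0 < r) (hrδ : r < δ) :
    sphericalPre m δ (Metric.closedBall x r)
      ≤ m (Metric.closedBall x r) / ENNReal.ofReal (2 * r) := by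
  refine (OuterMeasure.boundedBy_le _).trans ?_
  exact iInf_le_of_le x (iInf_le_of_le r (iInf_le_of_le hr (iInf_le_of_le hrδ (iInf_le _ rfl))))

/-- A cover by balls `B i` on which `f` oscillates by at most `L i * r i` around the value at the
centre covers the level set `{f = t}` by the balls with `t` in the corresponding interval. -/
theorem sphericalPre_inter_preimage_le {ι : Type*} [Countable ι] {f : X → ℝ} {δ : ℝ} {x : ι → X}
    {r L : ι → ℝ} (hr : ∀ i, 0 < r i) (hrδ : ∀ i, r i < δ)
    (hosc : ∀ i, ∀ y ∈ Metric.closedBall (x i) (r i), |f y - f (x i)| ≤ L i * r i) {A : Set X}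
    (hA : A ⊆ ⋃ i, Metric.closedBall (x i) (r i)) (t : ℝ) :
    sphericalPre m δ (A ∩ f ⁻¹' {t}) ≤
      ∑' i, (Icc (f (x i) - L i * r i) (f (x i) + L i * r i)).indicator
        (fun _ => m (Metric.closedBall (x i) (r i)) / ENNReal.ofReal (2 * r i)) t := by
  have h1 : A ∩ f ⁻¹' {t} ⊆ ⋃ i, (Metric.closedBall (x i) (r i) ∩ f ⁻¹' {t}) := by
    rw [← iUnion_inter]
    exact inter_subset_inter_left _ hA
  refine (measure_mono h1).trans ((measure_iUnion_le _).trans (ENNReal.tsum_le_tsum fun i => ?_))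
  rcases (Metric.closedBall (x i) (r i) ∩ f ⁻¹' {t}).eq_empty_or_nonempty with h | ⟨y, hy, hyt⟩
  · rw [h, measure_empty]
    exact zero_le
  · have hyt' : f y = t := hyt
    have h2 := abs_le.1 (hosc i y hy)
    rw [indicator_of_mem (by rw [← hyt']; exact ⟨by linarith, by linarith⟩)]
    exact (measure_mono inter_subset_left).trans (sphericalPre_closedBall_le _ (hr i) (hrδ i))

/-- The interval of values on a ball is as long as its diameter times the Lipschitz bound; this
cancels the radius in the gauge. -/
theorem setLIntegral_tsum_indicator_le {ι : Type*} [Countable ι] {c : ι → ℝ} {r L : ι → ℝ}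
    (hr : ∀ i, 0 < r i) (μ : ι → ℝ≥0∞) (J : Set ℝ) :
    ∫⁻ t in J, ∑' i, (Icc (c i - L i * r i) (c i + L i * r i)).indicator
        (fun _ => μ i / ENNReal.ofReal (2 * r i)) t ≤
      ∑' i, {i | (Icc (c i - L i * r i) (c i + L i * r i) ∩ J).Nonempty}.indicator
        (fun i => ENNReal.ofReal (L i) * μ i) i := by
  rw [lintegral_tsum fun i => (measurable_const.indicator measurableSet_Icc).aemeasurable]
  refine ENNReal.tsum_le_tsum fun i => ?_
  rw [lintegral_indicator_const measurableSet_Icc, Measure.restrict_apply measurableSet_Icc]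
  by_cases h : (Icc (c i - L i * r i) (c i + L i * r i) ∩ J).Nonempty
  · rw [indicator_of_mem (by exact h)]
    have hr2 : 0 < 2 * r i := by linarith [hr i]
    calc μ i / ENNReal.ofReal (2 * r i) * volume (Icc (c i - L i * r i) (c i + L i * r i) ∩ J)
        ≤ μ i / ENNReal.ofReal (2 * r i) * ENNReal.ofReal (2 * r i * L i) := by
          gcongr
          refine (measure_mono inter_subset_left).trans ?_
          rw [Real.volume_Icc]
          exact ENNReal.ofReal_le_ofReal (by linarith)
      _ = ENNReal.ofReal (L i) * μ i := by
          rw [ENNReal.ofReal_mul hr2.le, ← mul_assoc, ENNReal.div_mul_cancel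
            (by simpa using hr i) ENNReal.ofReal_ne_top, mul_comm]
  · rw [not_nonempty_iff_eq_empty.1 h, measure_empty, mul_zero]
    exact zero_le

variable [BorelSpace X]

/-- Null sets are covered by small balls of small total measure: the disjoint balls selected by the
Vitali covering lemma stay in a neighbourhood of small measure, and doubling controls the enlarged
balls. -/
theorem IsDoubling.exists_cover_of_measure_eq_zero [CompleteSpace X] (hm : IsDoubling m)
    {N : Set X} (hN : m N = 0) {δ : ℝ} (hδ : 0 < δ) {η : ℝ≥0∞} (hη : 0 < η) :
    ∃ (u : Set X) (r : X → ℝ), u.Countable ∧ (∀ x ∈ u, 0 < r x) ∧ (∀ x ∈ u, r x < δ) ∧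
      N ⊆ ⋃ x : u, Metric.closedBall (x : X) (r x) ∧
      ∑' x : u, m (Metric.closedBall (x : X) (r x)) ≤ η := by
  have := hm.properSpace
  have := hm.isLocallyFiniteMeasure
  obtain ⟨C, hC⟩ := hm.exists_measure_ball_two_pow_mul_le
  have hη' : m N < η / (C ^ 3 + 1) := by
    rw [hN]
    exact ENNReal.div_pos hη.ne' (by finiteness)
  obtain ⟨V, hNV, hV, hVη⟩ := N.exists_isOpen_lt_of_lt _ hη'
  have hex : ∀ x, ∃ ρ : ℝ, x ∈ N → 0 < ρ ∧ ρ < δ / 5 ∧ Metric.closedBall x ρ ⊆ V := by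
    intro x
    by_cases hx : x ∈ N
    · obtain ⟨ρ, hρ, hsub⟩ := Metric.nhds_basis_closedBall.mem_iff.1 (hV.mem_nhds (hNV hx))
      refine ⟨min ρ (δ / 10), fun _ => ⟨lt_min hρ (by positivity), ?_, ?_⟩⟩
      · exact (min_le_right _ _).trans_lt (by linarith)
      · exact (Metric.closedBall_subset_closedBall (min_le_left _ _)).trans hsub
    · exact ⟨0, fun h => absurd h hx⟩
  choose ρ hρ using hex
  obtain ⟨u, huN, hdisj, hcov⟩ := Vitali.exists_disjoint_subfamily_covering_enlargement_closedBall
    N (fun y => y) ρ (δ / 5) (fun x hx => (hρ x hx).2.1.le) 5 (by norm_num)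
  have hcount : u.Countable := hdisj.countable_of_nonempty_interior fun x hx =>
    ⟨x, Metric.ball_subset_interior_closedBall (Metric.mem_ball_self (hρ x (huN hx)).1)⟩
  refine ⟨u, fun x => 5 * ρ x, hcount, fun x hx => by linarith [(hρ x (huN hx)).1],
    fun x hx => by linarith [(hρ x (huN hx)).2.1], fun x hx => ?_, ?_⟩
  · obtain ⟨b, hb, hsub⟩ := hcov x hx
    exact mem_iUnion.2 ⟨⟨b, hb⟩, hsub (Metric.mem_closedBall_self (hρ x hx).1.le)⟩
  · have := hcount.to_subtype
    calc ∑' x : u, m (Metric.closedBall (x : X) (5 * ρ x))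
        ≤ ∑' x : u, C ^ 3 * m (Metric.closedBall (x : X) (ρ x)) := by
          refine ENNReal.tsum_le_tsum fun x => ?_
          have h0 := (hρ x (huN x.2)).1
          refine (measure_mono (Metric.closedBall_subset_ball ?_)).trans
            ((hC 3 x (ρ x) h0).trans ?_)
          · linarith
          · gcongr
            exact Metric.ball_subset_closedBall
      _ = C ^ 3 * ∑' x : u, m (Metric.closedBall (x : X) (ρ x)) := ENNReal.tsum_mul_left
      _ ≤ C ^ 3 * m V := by
          gcongr
          rw [← measure_iUnion (f := fun x : u => Metric.closedBall (x : X) (ρ x))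
            (fun a b hab => hdisj a.2 b.2 fun h => hab (Subtype.ext h))
            fun x => Metric.isClosed_closedBall.measurableSet]
          exact measure_mono (iUnion_subset fun x => (hρ x (huN x.2)).2.2)
      _ ≤ (C ^ 3 + 1) * (η / (C ^ 3 + 1)) := by
          gcongr
          exact le_self_add
      _ ≤ η := ENNReal.mul_div_le

/-- Almost all of an open set is covered by small disjoint balls on which the oscillation of `f` is
controlled by the slope at the centre, and the slope at the centre by its mean value. -/
theorem IsDoubling.exists_disjoint_balls [CompleteSpace X] (hm : IsDoubling m) {f : X → ℝ}
    {K : ℝ≥0} (hf : LipschitzWith K f) {W : Set X} (hW : IsOpen W) (hWm : m W < ∞) {δ ε : ℝ}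
    (hδ : 0 < δ) (hε : 0 < ε) :
    ∃ (ι : Type u) (_ : Countable ι) (x : ι → X) (r : ι → ℝ),
      (∀ i, 0 < r i) ∧ (∀ i, r i < δ) ∧ (∀ i, Metric.closedBall (x i) (r i) ⊆ W) ∧
      Pairwise (Function.onFun Disjoint fun i => Metric.closedBall (x i) (r i)) ∧
      (∀ i, ∀ y ∈ Metric.closedBall (x i) (r i),
        |f y - f (x i)| ≤ ((slope f (x i)).toReal + ε) * r i) ∧
      (∀ i, slope f (x i) * m (Metric.closedBall (x i) (r i)) ≤
        ∫⁻ y in Metric.closedBall (x i) (r i), slope f y ∂m +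
          ENNReal.ofReal ε * m (Metric.closedBall (x i) (r i))) ∧
      m (W \ ⋃ i, Metric.closedBall (x i) (r i)) = 0 := by
  have := hm.properSpace
  have := hm.isLocallyFiniteMeasure
  have := hm.isUnifLocDoublingMeasure
  have hslopetop : ∀ x, slope f x ≠ ∞ := fun x =>
    ((slope_le_of_lipschitz hf x).trans_lt ENNReal.coe_lt_top).ne
  set v := IsUnifLocDoublingMeasure.vitaliFamily m 1 with hv
  have hmeas : Measurable (W.indicator (slope f)) :=
    (measurable_slope hf.continuous).indicator hW.measurableSet
  have hfin : ∫⁻ x, W.indicator (slope f) x ∂m ≠ ∞ := by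
    refine ne_top_of_le_ne_top (ENNReal.mul_ne_top (ENNReal.coe_ne_top (r := K)) hWm.ne) ?_
    rw [lintegral_indicator hW.measurableSet, ← setLIntegral_const]
    exact lintegral_mono fun x => slope_le_of_lipschitz hf x
  have hae := v.ae_tendsto_lintegral_div hmeas.aemeasurable hfin
  -- the points of `W` that are Lebesgue points of the slope
  set s : Set X := {x ∈ W | Tendsto (fun a => (∫⁻ y in a, W.indicator (slope f) y ∂m) / m a)
    (v.filterAt x) (𝓝 (W.indicator (slope f) x))} with hs
  have hsW : m (W \ s) = 0 := by
    refine measure_mono_null (fun x hx => ?_) hae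
    exact fun h => hx.2 ⟨hx.1, h⟩
  let Q : X → ℝ → Prop := fun x r => 0 < r ∧ r < δ ∧ Metric.closedBall x r ⊆ W ∧
    (∀ y ∈ Metric.closedBall x r, |f y - f x| ≤ ((slope f x).toReal + ε) * r) ∧
    slope f x * m (Metric.closedBall x r) ≤ ∫⁻ y in Metric.closedBall x r, slope f y ∂m +
      ENNReal.ofReal ε * m (Metric.closedBall x r)
  have hfine : v.FineSubfamilyOn (fun x => {B | ∃ r, Q x r ∧ B = Metric.closedBall x r}) s := by
    rintro x ⟨hxW, hx⟩ η hη
    have hball : Tendsto (fun r : ℝ => Metric.closedBall x r) (𝓝[>] 0) (v.filterAt x) := by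
      refine IsUnifLocDoublingMeasure.tendsto_closedBall_filterAt m (fun _ => x) id tendsto_id ?_
      filter_upwards [self_mem_nhdsWithin] with r hr
      exact Metric.mem_closedBall_self (by simpa using (le_of_lt hr))
    have h1 : ∀ᶠ r in 𝓝[>] (0 : ℝ), slope f x < (∫⁻ y in Metric.closedBall x r,
        W.indicator (slope f) y ∂m) / m (Metric.closedBall x r) + ENNReal.ofReal ε := by
      have h2 := (hx.comp hball).add_const (ENNReal.ofReal ε)
      rw [indicator_of_mem hxW] at h2
      exact h2.eventually_const_lt
        (ENNReal.lt_add_right (hslopetop x) (by simpa using hε))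
    obtain ⟨ρ, hρ, hρsub⟩ := Metric.mem_nhds_iff.1
      (inter_mem (hW.mem_nhds hxW) (eventually_of_slope_ne_top (hslopetop x) hε))
    have h3 : ∀ᶠ r in 𝓝[>] (0 : ℝ), r < min δ (min ρ η) := by
      have : Iio (min δ (min ρ η)) ∈ 𝓝 (0 : ℝ) := Iio_mem_nhds (by positivity)
      exact nhdsWithin_le_nhds this
    obtain ⟨r, hr1, hr2, hr0⟩ := (h1.and (h3.and self_mem_nhdsWithin)).exists
    have hr0 : 0 < r := hr0
    have hrδ : r < δ := hr2.trans_le (min_le_left _ _)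
    have hrρ : r < ρ := hr2.trans_le ((min_le_right _ _).trans (min_le_left _ _))
    have hrη : r < η := hr2.trans_le ((min_le_right _ _).trans (min_le_right _ _))
    have hsub : Metric.closedBall x r ⊆ Metric.ball x ρ := Metric.closedBall_subset_ball hrρ
    have hWsub : Metric.closedBall x r ⊆ W := fun y hy => (hρsub (hsub hy)).1
    refine ⟨Metric.closedBall x r, ⟨?_, r, ⟨hr0, hrδ, hWsub, fun y hy => ?_, ?_⟩, rfl⟩,
      Metric.closedBall_subset_closedBall hrη.le⟩
    · exact IsUnifLocDoublingMeasure.closedBall_mem_vitaliFamily_of_dist_le_mul m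
        (by simpa using hr0.le) hr0
    · refine ((hρsub (hsub hy)).2 : |f y - f x| ≤ _).trans ?_
      gcongr
      exact hy
    · have hpos : m (Metric.closedBall x r) ≠ 0 :=
        ((hm.1 x r hr0).1.trans_le (measure_mono Metric.ball_subset_closedBall)).ne'
      have hlt : m (Metric.closedBall x r) ≠ ∞ :=
        (measure_closedBall_lt_top (μ := m)).ne
      have h4 : ∫⁻ y in Metric.closedBall x r, W.indicator (slope f) y ∂m =
          ∫⁻ y in Metric.closedBall x r, slope f y ∂m :=
        setLIntegral_congr_fun Metric.isClosed_closedBall.measurableSet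
          fun y hy => indicator_of_mem (hWsub hy) _
      rw [h4] at hr1
      calc slope f x * m (Metric.closedBall x r) ≤ _ := mul_le_mul_left hr1.le _
        _ = _ := by rw [add_mul, ENNReal.div_mul_cancel hpos hlt]
  have hmem : ∀ p : hfine.index, ∃ r, Q (p : X × Set X).1 r ∧
      hfine.covering p = Metric.closedBall (p : X × Set X).1 r := fun p => hfine.covering_mem p.2
  choose r hQ hr using hmem
  have hcount := hfine.index_countable.to_subtype
  refine ⟨hfine.index, hcount, fun p => (p : X × Set X).1, r, fun p => (hQ p).1,
    fun p => (hQ p).2.1, fun p => (hQ p).2.2.1, ?_, fun p => (hQ p).2.2.2.1,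
    fun p => (hQ p).2.2.2.2, ?_⟩
  · simp only [← hr]
    exact hfine.covering_disjoint_subtype
  · simp only [← hr]
    refine measure_mono_null (t := (W \ s) ∪ (s \ ⋃ p ∈ hfine.index, hfine.covering p)) ?_
      (measure_union_null hsW hfine.measure_sdiff_biUnion)
    rintro x ⟨hxW, hx⟩
    by_cases hxs : x ∈ s
    · refine Or.inr ⟨hxs, fun h => hx ?_⟩
      rw [biUnion_eq_iUnion] at h
      exact h
    · exact Or.inl ⟨hxW, hxs⟩

end Spherical

section SphericalLevel

universe u

variable {X : Type u} [MetricSpace X] [MeasurableSpace X] [BorelSpace X] {m : Measure X}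

/-- The bounding function `G` is a sum of two: one for the disjoint balls that cover almost all of `W`,
and one for balls that cover the remaining null set. The enlargement of `J` accounts for balls on which
`f` takes values both in and outside `J`. -/
theorem IsDoubling.exists_sphericalPre_le [CompleteSpace X] (hm : IsDoubling m) {f : X → ℝ}
    {K : ℝ≥0} (hf : LipschitzWith K f) {W : Set X} (hW : IsOpen W) (hWm : m W < ∞) {δ ε : ℝ}
    (hδ : 0 < δ) (hε : 0 < ε) (hε1 : ε ≤ 1) :
    ∃ G : ℝ → ℝ≥0∞, Measurable G ∧ (∀ t, sphericalPre m δ (W ∩ f ⁻¹' {t}) ≤ G t) ∧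
      ∀ J : Set ℝ, ∫⁻ t in J, G t ≤
        ∫⁻ x in W ∩ f ⁻¹' (Metric.cthickening (2 * (K + 1) * δ) J), slope f x ∂m +
          ENNReal.ofReal ε * (2 * m W + K) := by
  obtain ⟨ι, hι, x, r, hr, hrδ, hxW, hdisj, hosc, hslope, hnull⟩ :=
    hm.exists_disjoint_balls hf hW hWm hδ hε
  obtain ⟨u, ρ, hu, hρ, hρδ, hcov, hsum⟩ := hm.exists_cover_of_measure_eq_zero hnull hδ
    (ENNReal.ofReal_pos.2 hε)
  have := hu.to_subtype
  set L : ι → ℝ := fun i => (slope f (x i)).toReal + ε with hL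
  set B : ι → Set X := fun i => Metric.closedBall (x i) (r i) with hB
  have hslopetop : ∀ x, slope f x ≠ ∞ := fun x =>
    ((slope_le_of_lipschitz hf x).trans_lt ENNReal.coe_lt_top).ne
  set G₁ : ℝ → ℝ≥0∞ := fun t => ∑' i, (Icc (f (x i) - L i * r i) (f (x i) + L i * r i)).indicator
        (fun _ => m (B i) / ENNReal.ofReal (2 * r i)) t with hG₁
  set G₂ : ℝ → ℝ≥0∞ := fun t => ∑' y : u, (Icc (f y - K * ρ y) (f y + K * ρ y)).indicator
        (fun _ => m (Metric.closedBall (y : X) (ρ y)) / ENNReal.ofReal (2 * ρ y)) t with hG₂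
  have hG₁m : Measurable G₁ := Measurable.tsum fun i =>
    measurable_const.indicator measurableSet_Icc
  have hG₂m : Measurable G₂ := Measurable.tsum fun i =>
    measurable_const.indicator measurableSet_Icc
  refine ⟨fun t => G₁ t + G₂ t, hG₁m.add hG₂m, fun t => ?_, fun J => ?_⟩
  · have hsub : W ∩ f ⁻¹' {t} ⊆ ((⋃ i, B i) ∩ f ⁻¹' {t}) ∪ ((W \ ⋃ i, B i) ∩ f ⁻¹' {t}) := by
      rintro y ⟨hy, hyt⟩
      by_cases h : y ∈ ⋃ i, B i
      · exact Or.inl ⟨h, hyt⟩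
      · exact Or.inr ⟨⟨hy, h⟩, hyt⟩
    refine (measure_mono hsub).trans ((measure_union_le _ _).trans (add_le_add ?_ ?_))
    · exact sphericalPre_inter_preimage_le hr hrδ hosc subset_rfl t
    · refine sphericalPre_inter_preimage_le (x := fun y : u => (y : X)) (r := fun y : u => ρ y)
        (L := fun _ => (K : ℝ)) (fun y => hρ y y.2) (fun y => hρδ y y.2) (fun y z hz => ?_) hcov t
      refine (by simpa [Real.dist_eq] using hf.dist_le_mul z y : |f z - f y| ≤ K * dist z y).trans ?_
      gcongr
      exact hz
  · rw [lintegral_add_left hG₁m]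
    set C : Set ℝ := Metric.cthickening (2 * (K + 1) * δ) J with hC
    have hfC : MeasurableSet (f ⁻¹' C) :=
      hf.continuous.measurable Metric.isClosed_cthickening.measurableSet
    have hBm : ∀ i, MeasurableSet (B i) := fun i => Metric.isClosed_closedBall.measurableSet
    have h2 : ∫⁻ t in J, G₂ t ≤ ENNReal.ofReal ε * K := by
      refine (setLIntegral_tsum_indicator_le (c := fun y : u => f y) (r := fun y : u => ρ y)
        (L := fun _ => (K : ℝ)) (fun y => hρ y y.2) _ J).trans ?_
      refine (ENNReal.tsum_le_tsum fun y => indicator_le_self' (fun _ _ => zero_le) y).trans ?_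
      rw [ENNReal.tsum_mul_left, ENNReal.ofReal_coe_nnreal, mul_comm]
      gcongr
    have hterm : ∀ i, {i | (Icc (f (x i) - L i * r i) (f (x i) + L i * r i) ∩ J).Nonempty}.indicator
        (fun i => ENNReal.ofReal (L i) * m (B i)) i ≤
        ∫⁻ y in B i, (f ⁻¹' C).indicator (slope f) y ∂m + 2 * ENNReal.ofReal ε * m (B i) := by
      intro i
      refine indicator_apply_le' (fun hi => ?_) (fun _ => zero_le)
      obtain ⟨t, ht, htJ⟩ := hi
      have hLK : L i ≤ K + 1 := by
        have h := ENNReal.toReal_mono ENNReal.coe_ne_top (slope_le_of_lipschitz hf (x i))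
        rw [ENNReal.coe_toReal] at h
        simp only [hL]
        linarith
      have hL0 : 0 ≤ L i := add_nonneg ENNReal.toReal_nonneg hε.le
      have hBC : B i ⊆ f ⁻¹' C := by
        intro y hy
        refine Metric.mem_cthickening_of_dist_le (f y) t _ J htJ ?_
        have h3 := abs_le.1 (hosc i y hy)
        have h4 : L i * r i ≤ (K + 1) * δ := mul_le_mul hLK (hrδ i).le (hr i).le (by positivity)
        have h5 : ((slope f (x i)).toReal + ε) * r i = L i * r i := rfl
        rw [h5] at h3
        rw [Real.dist_eq, abs_le]
        constructor <;> linarith [ht.1, ht.2, h3.1, h3.2]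
      have h6 : ∫⁻ y in B i, (f ⁻¹' C).indicator (slope f) y ∂m = ∫⁻ y in B i, slope f y ∂m :=
        setLIntegral_congr_fun (hBm i) fun y hy => indicator_of_mem (hBC hy) _
      rw [h6, hL, ENNReal.ofReal_add ENNReal.toReal_nonneg hε.le,
        ENNReal.ofReal_toReal (hslopetop _), add_mul, two_mul, add_mul, ← add_assoc]
      gcongr
      exact hslope i
    have h1 : ∫⁻ t in J, G₁ t ≤ ∫⁻ y in W ∩ f ⁻¹' C, slope f y ∂m +
        2 * ENNReal.ofReal ε * m W := by
      refine (setLIntegral_tsum_indicator_le (c := fun i => f (x i)) hr _ J).trans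
        ((ENNReal.tsum_le_tsum hterm).trans ?_)
      rw [ENNReal.tsum_add, ENNReal.tsum_mul_left, ← lintegral_iUnion hBm hdisj,
        ← measure_iUnion hdisj hBm, lintegral_indicator hfC,
        Measure.restrict_restrict hfC, inter_comm]
      gcongr
      · exact iUnion_subset hxW
      · exact iUnion_subset hxW
    calc _ ≤ _ := add_le_add h1 h2
      _ = _ := by ring

/-- An Eilenberg type inequality: the spherical measures of the level sets of `f` in `U` are bounded
by a function whose integral over a closed set of levels is at most the level measure. -/
theorem IsDoubling.exists_sphericalOuter_le [CompleteSpace X] (hm : IsDoubling m) {f : X → ℝ}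
    (hf : ∃ K : ℝ≥0, LipschitzWith K f) {a : ℝ} (hfin : m (f ⁻¹' Ioi a) < ∞)
    {U : Set X} (hU : IsOpen U) :
    ∃ G : ℝ → ℝ≥0∞, Measurable G ∧ (∀ t, a < t → sphericalOuter m (U ∩ f ⁻¹' {t}) ≤ G t) ∧
      ∀ J : Set ℝ, IsClosed J → ∫⁻ t in J, G t ≤ levelMeasure m f a U J := by
  have hρ := isFiniteMeasure_levelMeasure hf hfin U
  obtain ⟨K, hK⟩ := hf
  have hc := hK.continuous
  set W : Set X := U ∩ f ⁻¹' Ioi a with hWdef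
  have hW : IsOpen W := hU.inter (isOpen_Ioi.preimage hc)
  have hWm : m W < ∞ := (measure_mono inter_subset_right).trans_lt hfin
  have hpos : ∀ n : ℕ, (0 : ℝ) < 1 / (n + 1) := fun n => by positivity
  have hle1 : ∀ n : ℕ, (1 : ℝ) / (n + 1) ≤ 1 := fun n => by
    rw [div_le_one (by positivity)]
    linarith [n.cast_nonneg (α := ℝ)]
  choose G hGm hGS hGJ using fun n : ℕ =>
    hm.exists_sphericalPre_le hK hW hWm (hpos n) (hpos n) (hle1 n)
  have hlim : Tendsto (fun n : ℕ => (1 : ℝ) / (n + 1)) atTop (𝓝 0) :=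
    tendsto_one_div_add_atTop_nhds_zero_nat
  refine ⟨fun t => liminf (fun n => G n t) atTop, Measurable.liminf hGm, fun t hat => ?_,
    fun J hJ => ?_⟩
  · have hWt : U ∩ f ⁻¹' {t} ⊆ W ∩ f ⁻¹' {t} := by
      rintro y ⟨hy, hyt⟩
      have hyt' : f y = t := hyt
      exact ⟨⟨hy, by simpa [hyt'] using hat⟩, hyt⟩
    simp only [sphericalOuter, OuterMeasure.iSup_apply]
    refine iSup₂_le fun δ hδ => le_liminf_of_le (by isBoundedDefault) ?_
    filter_upwards [hlim.eventually_lt_const hδ] with n hn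
    exact (sphericalPre_anti m hn.le _).trans ((measure_mono hWt).trans (hGS n t))
  · have hlev : ∀ C : Set ℝ, IsClosed C →
        ∫⁻ x in W ∩ f ⁻¹' C, slope f x ∂m = levelMeasure m f a U C := by
      intro C hC
      rw [levelMeasure_apply hc hC.measurableSet, slopeMeasure_apply hc
        (hU.measurableSet.inter (hc.measurable hC.measurableSet)), hWdef, inter_right_comm]
    have h1 : Tendsto (fun n : ℕ => levelMeasure m f a U
        (Metric.cthickening (2 * (K + 1) * (1 / (n + 1))) J)) atTop (𝓝 (levelMeasure m f a U J)) := by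
      refine (tendsto_measure_cthickening_of_isClosed ⟨1, one_pos, measure_ne_top _ _⟩ hJ).comp ?_
      simpa using hlim.const_mul (2 * ((K : ℝ) + 1))
    have h2 : Tendsto (fun n : ℕ => ENNReal.ofReal (1 / ((n : ℝ) + 1)) * (2 * m W + K)) atTop
        (𝓝 (ENNReal.ofReal 0 * (2 * m W + K))) :=
      ENNReal.Tendsto.mul_const (ENNReal.tendsto_ofReal hlim) (Or.inr (by finiteness))
    have h3 := h1.add h2
    rw [ENNReal.ofReal_zero, zero_mul, add_zero] at h3
    rw [← h3.liminf_eq]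
    refine (lintegral_liminf_le hGm).trans (liminf_le_liminf (Eventually.of_forall fun n => ?_))
    rw [← hlev _ Metric.isClosed_cthickening]
    exact hGJ n J

/-- The spherical measure of almost every level set is at most the density of the level measure. -/
theorem IsDoubling.ae_sphericalOuter_le [CompleteSpace X] (hm : IsDoubling m) {f : X → ℝ}
    (hf : ∃ K : ℝ≥0, LipschitzWith K f) {a : ℝ} (hfin : m (f ⁻¹' Ioi a) < ∞)
    {U : Set X} (hU : IsOpen U)
    (hac : volume.withDensity ((levelMeasure m f a U).rnDeriv volume) = levelMeasure m f a U) :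
    ∀ᵐ t : ℝ, a < t →
      sphericalOuter m (U ∩ f ⁻¹' {t}) ≤ (levelMeasure m f a U).rnDeriv volume t := by
  have hρ := isFiniteMeasure_levelMeasure hf hfin U
  obtain ⟨G, hGm, hGS, hGJ⟩ := hm.exists_sphericalOuter_le hf hfin hU
  set ρ := levelMeasure m f a U with hρdef
  have hfinG : IsFiniteMeasure (volume.withDensity G) := by
    refine isFiniteMeasure_withDensity (ne_top_of_le_ne_top (measure_ne_top ρ univ) ?_)
    rw [← setLIntegral_univ]
    exact hGJ univ isClosed_univ
  have hle : volume.withDensity G ≤ volume.withDensity (ρ.rnDeriv volume) := by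
    rw [hac]
    -- inner regularity by closed sets reduces the comparison to closed sets of levels
    refine Measure.le_intro fun s hs _ => ?_
    rw [hs.measure_eq_iSup_isClosed_of_ne_top (measure_ne_top _ _)]
    refine iSup₂_le fun J hJs => iSup_le fun hJ => ?_
    rw [withDensity_apply _ hJ.measurableSet]
    exact (hGJ J hJ).trans (measure_mono hJs)
  have hae : G ≤ᵐ[volume] ρ.rnDeriv volume := by
    refine ae_le_of_forall_setLIntegral_le_of_sigmaFinite hGm fun s hs _ => ?_
    rw [← withDensity_apply _ hs, ← withDensity_apply _ hs]
    exact hle s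
  filter_upwards [hae] with t ht hat using (hGS t hat).trans ht

end SphericalLevel

/-! ### Gluing: the perimeter in open sets is at most the limit measure -/

section Gluing

variable {X : Type*} [MetricSpace X]

/-- A Lipschitz function that exhausts the complement of `F` as `j → ∞`. -/
noncomputable def exhaustion (F : Set X) (j : ℕ) (x : X) : ℝ := min (j * Metric.infDist x F) 1

theorem exhaustion_zero (F : Set X) (x : X) : exhaustion F 0 x = 0 := by simp [exhaustion]

theorem exhaustion_le_one (F : Set X) (j : ℕ) (x : X) : exhaustion F j x ≤ 1 := min_le_right _ _

theorem exhaustion_nonneg (F : Set X) (j : ℕ) (x : X) : 0 ≤ exhaustion F j x :=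
  le_min (mul_nonneg j.cast_nonneg Metric.infDist_nonneg) zero_le_one

theorem exhaustion_mono (F : Set X) (x : X) : Monotone fun j => exhaustion F j x := by
  intro i j hij
  have : (i : ℝ) ≤ j := by exact_mod_cast hij
  exact min_le_min_right _ (mul_le_mul_of_nonneg_right this Metric.infDist_nonneg)

theorem exhaustion_of_mem {F : Set X} {x : X} (hx : x ∈ F) (j : ℕ) : exhaustion F j x = 0 := by
  simp [exhaustion, Metric.infDist_zero_of_mem hx]

theorem lipschitzWith_exhaustion (F : Set X) (j : ℕ) : LipschitzWith j (exhaustion F j) := by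
  refine LipschitzWith.min_const (LipschitzWith.of_dist_le_mul fun x y => ?_) 1
  rw [Real.dist_eq, ← mul_sub, abs_mul, abs_of_nonneg (j.cast_nonneg)]
  have := (Metric.lipschitz_infDist_pt F).dist_le_mul x y
  rw [NNReal.coe_one, one_mul, Real.dist_eq] at this
  rw [NNReal.coe_natCast]
  gcongr

/-- The increments of `exhaustion` form a partition of unity on the complement of `F`, locally finite
there. -/
noncomputable def exhaustionStep (F : Set X) (j : ℕ) (x : X) : ℝ :=
  exhaustion F (j + 1) x - exhaustion F j x

theorem exhaustionStep_nonneg (F : Set X) (j : ℕ) (x : X) : 0 ≤ exhaustionStep F j x :=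
  sub_nonneg.2 (exhaustion_mono F x j.le_succ)

theorem exhaustionStep_le_one (F : Set X) (j : ℕ) (x : X) : exhaustionStep F j x ≤ 1 := by
  have h1 := exhaustion_le_one F (j + 1) x
  have h2 := exhaustion_nonneg F j x
  rw [exhaustionStep]
  linarith

theorem lipschitzWith_exhaustionStep (F : Set X) (j : ℕ) :
    LipschitzWith ((j + 1 : ℕ) + j) (exhaustionStep F j) :=
  (lipschitzWith_exhaustion F (j + 1)).sub (lipschitzWith_exhaustion F j)

theorem sum_range_exhaustionStep (F : Set X) (N : ℕ) (x : X) :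
    ∑ j ∈ Finset.range N, exhaustionStep F j x = exhaustion F N x := by
  simp only [exhaustionStep]
  rw [Finset.sum_range_sub (fun j => exhaustion F j x), exhaustion_zero, sub_zero]

theorem exists_eventually_exhaustion_eq_one {F : Set X} (hF : IsClosed F) (hne : F.Nonempty) {x : X}
    (hx : x ∉ F) : ∃ N : ℕ, ∀ᶠ y in 𝓝 x, ∀ j ≥ N, exhaustion F j y = 1 := by
  have hpos : 0 < Metric.infDist x F := (hF.notMem_iff_infDist_pos hne).1 hx
  obtain ⟨N, hN⟩ := exists_nat_gt (2 / Metric.infDist x F)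
  refine ⟨N, ?_⟩
  have hev : ∀ᶠ y in 𝓝 x, Metric.infDist x F / 2 < Metric.infDist y F :=
    (Metric.continuous_infDist_pt F).continuousAt.eventually_const_lt (half_lt_self hpos)
  filter_upwards [hev] with y hy j hj
  refine min_eq_right ?_
  have h1 : (N : ℝ) ≤ j := by exact_mod_cast hj
  have h2 : 2 < N * Metric.infDist x F := (div_lt_iff₀ hpos).1 hN
  have h3 : (N : ℝ) * (Metric.infDist x F / 2) ≤ j * Metric.infDist y F :=
    mul_le_mul h1 hy.le (by positivity) (by positivity)
  linarith

variable [MeasurableSpace X] [BorelSpace X] {m : Measure X}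

/-- Portmanteau: lower bounds on open sets together with an upper bound of the total masses give
upper bounds for integrals of continuous functions. -/
theorem eventually_lintegral_le_of_isOpen_le_liminf {P : Measure X} [IsFiniteMeasure P]
    {ν : ℕ → Measure X} (hopen : ∀ U, IsOpen U → P U ≤ liminf (fun n => ν n U) atTop)
    (huniv : limsup (fun n => ν n univ) atTop ≤ P univ) {φ : X → ℝ} (hφ : Continuous φ)
    (h0 : ∀ x, 0 ≤ φ x) (h1 : ∀ x, φ x ≤ 1) {ε : ℝ≥0∞} (hε : 0 < ε) :
    ∀ᶠ n in atTop, ∫⁻ x, ENNReal.ofReal (φ x) ∂ν n ≤ ∫⁻ x, ENNReal.ofReal (φ x) ∂P + ε := by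
  have hε2 : 0 < ε / 2 := ENNReal.half_pos hε.ne'
  have hsplit : ∀ μ : Measure X, ∫⁻ x, ENNReal.ofReal (φ x) ∂μ +
      ∫⁻ x, ENNReal.ofReal (1 - φ x) ∂μ = μ univ := by
    intro μ
    rw [← lintegral_add_left hφ.measurable.ennreal_ofReal, ← lintegral_one]
    refine lintegral_congr fun x => ?_
    rw [← ENNReal.ofReal_add (h0 x) (sub_nonneg.2 (h1 x)), add_sub_cancel, ENNReal.ofReal_one]
  have hlow := lintegral_le_liminf_lintegral_of_forall_isOpen_measure_le_liminf_measure
    (f := fun x => 1 - φ x) (continuous_const.sub hφ) (fun x => sub_nonneg.2 (h1 x)) hopen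
  have hPfin : P univ ≠ ∞ := measure_ne_top P univ
  have hPfin' : ∫⁻ x, ENNReal.ofReal (1 - φ x) ∂P ≠ ∞ :=
    ne_top_of_le_ne_top hPfin (le_add_self.trans_eq (hsplit P))
  have hev1 : ∀ᶠ n in atTop, ν n univ < P univ + ε / 2 :=
    eventually_lt_of_limsup_lt (huniv.trans_lt (ENNReal.lt_add_right hPfin hε2.ne'))
  have hev2 : ∀ᶠ n in atTop, ∫⁻ x, ENNReal.ofReal (1 - φ x) ∂P ≤
      ∫⁻ x, ENNReal.ofReal (1 - φ x) ∂ν n + ε / 2 := by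
    by_cases hz : ∫⁻ x, ENNReal.ofReal (1 - φ x) ∂P = 0
    · rw [hz]
      exact Eventually.of_forall fun n => zero_le
    · have hlt : ∫⁻ x, ENNReal.ofReal (1 - φ x) ∂P - ε / 2 <
          liminf (fun n => ∫⁻ x, ENNReal.ofReal (1 - φ x) ∂ν n) atTop :=
        (ENNReal.sub_lt_self hPfin' hz hε2.ne').trans_le hlow
      filter_upwards [eventually_lt_of_lt_liminf hlt] with n hn
      exact tsub_le_iff_right.1 hn.le
  filter_upwards [hev1, hev2] with n h2 h3
  by_cases hεt : ε = ∞
  · simp [hεt]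
  have hfin : ∫⁻ x, ENNReal.ofReal (1 - φ x) ∂ν n ≠ ∞ := by
    refine ne_top_of_le_ne_top ?_ ((le_add_self.trans_eq (hsplit (ν n))).trans h2.le)
    exact ENNReal.add_ne_top.2 ⟨hPfin, (ENNReal.div_lt_top hεt two_ne_zero).ne⟩
  refine (ENNReal.add_le_add_iff_right hfin).1 ?_
  calc ∫⁻ x, ENNReal.ofReal (φ x) ∂ν n + ∫⁻ x, ENNReal.ofReal (1 - φ x) ∂ν n = ν n univ :=
        hsplit _
    _ ≤ P univ + ε / 2 := h2.le
    _ = ∫⁻ x, ENNReal.ofReal (φ x) ∂P + ∫⁻ x, ENNReal.ofReal (1 - φ x) ∂P + ε / 2 := by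
        rw [hsplit]
    _ ≤ ∫⁻ x, ENNReal.ofReal (φ x) ∂P +
        (∫⁻ x, ENNReal.ofReal (1 - φ x) ∂ν n + ε / 2) + ε / 2 := by gcongr
    _ = ∫⁻ x, ENNReal.ofReal (φ x) ∂P + (ε / 2 + ε / 2) +
        ∫⁻ x, ENNReal.ofReal (1 - φ x) ∂ν n := by ring
    _ = _ := by rw [ENNReal.add_halves]

/-- If the energies of a sequence of Lipschitz functions approximating `χ_A` converge to a measure
`P`, then gluing members of the sequence with a partition of unity of `U` gives approximations in `U`
of energy at most `P U`. -/
theorem perimeterIn_le_of_tendsto {A : Set X} (hA : MeasurableSet A) {P : Measure X}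
    [IsFiniteMeasure P] {u : ℕ → X → ℝ} (hu : ∀ n, ∃ K : ℝ≥0, LipschitzWith K (u n))
    (hlim : Tendsto (fun n => ∫⁻ x, ENNReal.ofReal |u n x - A.indicator (fun _ => (1 : ℝ)) x| ∂m)
      atTop (𝓝 0))
    (hopen : ∀ U, IsOpen U → P U ≤ liminf (fun n => ∫⁻ x in U, slope (u n) x ∂m) atTop)
    (huniv : limsup (fun n => ∫⁻ x, slope (u n) x ∂m) atTop ≤ P univ) {U : Set X} (hU : IsOpen U) :
    perimeterIn m A U ≤ P U := by
  rcases eq_or_ne U univ with rfl | hUne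
  · refine iInf₂_le_of_le u
      (fun n => (hu n).choose_spec.locallyLipschitz.locallyLipschitzOn) (iInf_le_of_le ?_ ?_)
    · simpa only [Measure.restrict_univ] using hlim
    · simp only [Measure.restrict_univ]
      exact (liminf_le_limsup).trans huniv
  set F : Set X := Uᶜ with hF
  have hFc : IsClosed F := hU.isClosed_compl
  have hFne : F.Nonempty := nonempty_compl.2 hUne
  have hum : ∀ n, Measurable (slope (u n)) := fun n =>
    measurable_slope (hu n).choose_spec.continuous
  have hdm : ∀ n, Measurable fun x =>
      ENNReal.ofReal |u n x - A.indicator (fun _ => (1 : ℝ)) x| := fun n =>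
    ((hu n).choose_spec.continuous.measurable.sub
      (measurable_const.indicator hA)).abs.ennreal_ofReal
  set φ : ℕ → X → ℝ := exhaustionStep F with hφ
  have hφc : ∀ j, Continuous (φ j) := fun j => (lipschitzWith_exhaustionStep F j).continuous
  set L : ℕ → ℝ≥0 := fun j => ((j + 1 : ℕ) + j) with hL
  refine perimeterIn_le_of_forall_exists fun ε hε => ?_
  obtain ⟨η, hη, hηsum⟩ := ENNReal.exists_pos_sum_of_countable (ε := ε / 2)
    (ENNReal.half_pos (by exact_mod_cast hε.ne')).ne' ℕ
  have hex : ∀ j, ∃ n, ∫⁻ x, ENNReal.ofReal |u n x - A.indicator (fun _ => (1 : ℝ)) x| ∂m ≤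
      η j / (L j + 1) ∧ ∫⁻ x, ENNReal.ofReal (φ j x) * slope (u n) x ∂m ≤
        ∫⁻ x, ENNReal.ofReal (φ j x) ∂P + η j := by
    intro j
    have hηj : (0 : ℝ≥0∞) < η j := by exact_mod_cast hη j
    have h1 : ∀ᶠ n in atTop,
        ∫⁻ x, ENNReal.ofReal |u n x - A.indicator (fun _ => (1 : ℝ)) x| ∂m < η j / (L j + 1) :=
      hlim.eventually_lt_const (ENNReal.div_pos hηj.ne' (by finiteness))
    have h2 := eventually_lintegral_le_of_isOpen_le_liminf (P := P)
      (ν := fun n => m.withDensity (slope (u n)))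
      (fun V hV => by simpa only [withDensity_apply _ hV.measurableSet] using hopen V hV)
      (by simpa only [withDensity_apply _ MeasurableSet.univ, setLIntegral_univ] using huniv)
      (hφc j) (exhaustionStep_nonneg F j) (exhaustionStep_le_one F j) hηj
    obtain ⟨n, hn1, hn2⟩ := (h1.and h2).exists
    refine ⟨n, hn1.le, ?_⟩
    rw [lintegral_withDensity_eq_lintegral_mul _ (hum n) (hφc j).measurable.ennreal_ofReal] at hn2
    refine (lintegral_congr fun x => ?_).trans_le hn2
    rw [Pi.mul_apply, mul_comm]
  choose n hn1 hn2 using hex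
  -- near a point of `U` only finitely many terms are present
  have hloc : ∀ x ∈ U, ∃ N : ℕ, ∀ᶠ y in 𝓝 x, (∑ j ∈ Finset.range N, φ j y = 1) ∧
      ∑' j, φ j y * u (n j) y = ∑ j ∈ Finset.range N, φ j y * u (n j) y := by
    intro x hx
    obtain ⟨N, hN⟩ := exists_eventually_exhaustion_eq_one hFc hFne (x := x) (by simpa [hF] using hx)
    refine ⟨N, hN.mono fun y hy => ⟨?_, ?_⟩⟩
    · rw [hφ, sum_range_exhaustionStep, hy N le_rfl]
    · refine tsum_eq_sum fun j hj => ?_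
      have hj' : N ≤ j := by simpa using hj
      have : φ j y = 0 := by
        simp only [hφ, exhaustionStep]
        rw [hy j hj', hy (j + 1) (hj'.trans j.le_succ), sub_self]
      rw [this, zero_mul]
  set w : X → ℝ := fun x => ∑' j, φ j x * u (n j) x with hw
  have hsum1 : ∑' j, (η j : ℝ≥0∞) ≤ ε / 2 := hηsum.le
  have hdist : ∀ j, (L j + 1) * ∫⁻ x in U,
      ENNReal.ofReal |u (n j) x - A.indicator (fun _ => (1 : ℝ)) x| ∂m ≤ η j := by
    intro j
    calc _ ≤ (L j + 1) * (η j / (L j + 1) : ℝ≥0∞) := by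
          gcongr
          exact (setLIntegral_le_lintegral _ _).trans (hn1 j)
      _ ≤ η j := ENNReal.mul_div_le
  refine ⟨w, ?_, ?_, ?_⟩
  · refine locallyLipschitzOn_of_eventuallyEq fun x hx => ?_
    obtain ⟨N, hN⟩ := hloc x hx
    refine ⟨fun y => ∑ j ∈ Finset.range N, φ j y * u (n j) y, univ, isOpen_univ, mem_univ x,
      locallyLipschitzOn_sum _ fun j _ => ?_, hN.mono fun y hy => hy.2⟩
    exact ((lipschitzWith_exhaustionStep F j).locallyLipschitz.locallyLipschitzOn).mul_real
      (hu (n j)).choose_spec.locallyLipschitz.locallyLipschitzOn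
  · calc ∫⁻ x in U, ENNReal.ofReal |w x - A.indicator (fun _ => (1 : ℝ)) x| ∂m
        ≤ ∫⁻ x in U, ∑' j,
            ENNReal.ofReal |u (n j) x - A.indicator (fun _ => (1 : ℝ)) x| ∂m := by
          refine setLIntegral_mono' hU.measurableSet fun x hx => ?_
          obtain ⟨N, hN⟩ := hloc x hx
          obtain ⟨h1, h2⟩ := hN.self_of_nhds
          have h3 : w x - A.indicator (fun _ => (1 : ℝ)) x = ∑ j ∈ Finset.range N,
              φ j x * (u (n j) x - A.indicator (fun _ => (1 : ℝ)) x) := by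
            simp only [mul_sub, Finset.sum_sub_distrib, ← Finset.sum_mul, h1, one_mul]
            rw [← h2]
          rw [h3]
          refine le_trans ?_ (ENNReal.sum_le_tsum (Finset.range N))
          rw [← ENNReal.ofReal_sum_of_nonneg fun _ _ => abs_nonneg _]
          refine ENNReal.ofReal_le_ofReal ((Finset.abs_sum_le_sum_abs _ _).trans
            (Finset.sum_le_sum fun j _ => ?_))
          rw [abs_mul, abs_of_nonneg (exhaustionStep_nonneg F j x)]
          exact mul_le_of_le_one_left (abs_nonneg _) (exhaustionStep_le_one F j x)
      _ = ∑' j, ∫⁻ x in U,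
            ENNReal.ofReal |u (n j) x - A.indicator (fun _ => (1 : ℝ)) x| ∂m :=
          lintegral_tsum fun j => (hdm (n j)).aemeasurable
      _ ≤ ∑' j, (η j : ℝ≥0∞) := by
          refine ENNReal.tsum_le_tsum fun j => le_trans ?_ (hdist j)
          exact le_mul_of_one_le_left zero_le le_add_self
      _ ≤ ε := hsum1.trans ENNReal.half_le_self
  · calc ∫⁻ x in U, slope w x ∂m
        ≤ ∫⁻ x in U, ∑' j, (ENNReal.ofReal (φ j x) * slope (u (n j)) x + (L j + 1) *
            ENNReal.ofReal |u (n j) x - A.indicator (fun _ => (1 : ℝ)) x|) ∂m := by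
          refine setLIntegral_mono' hU.measurableSet fun x hx => ?_
          obtain ⟨N, hN⟩ := hloc x hx
          rw [slope_congr (hN.mono fun y hy => hy.2)]
          have hφs : ∀ j, slope (φ j) x ≤ L j := fun j =>
            slope_le_of_lipschitz (lipschitzWith_exhaustionStep F j) x
          refine (slope_sum_mul_le (Finset.range N) (A.indicator (fun _ => (1 : ℝ)) x)
            (hN.mono fun y hy => hy.1) (fun j _ => exhaustionStep_nonneg F j x)
            (fun j _ => ((hφs j).trans_lt ENNReal.coe_lt_top).ne) (fun j _ =>
              ((slope_le_of_lipschitz (hu (n j)).choose_spec x).trans_lt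
                ENNReal.coe_lt_top).ne)).trans ?_
          refine le_trans (Finset.sum_le_sum fun j _ => ?_) (ENNReal.sum_le_tsum (Finset.range N))
          rw [mul_comm (ENNReal.ofReal |u (n j) x - _|)]
          gcongr
          exact (hφs j).trans le_self_add
      _ = ∑' j, (∫⁻ x in U, ENNReal.ofReal (φ j x) * slope (u (n j)) x ∂m + (L j + 1) *
            ∫⁻ x in U, ENNReal.ofReal |u (n j) x - A.indicator (fun _ => (1 : ℝ)) x| ∂m) := by
          have hm1 : ∀ j, Measurable fun x => ENNReal.ofReal (φ j x) * slope (u (n j)) x :=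
            fun j => (hφc j).measurable.ennreal_ofReal.mul (hum (n j))
          refine (lintegral_tsum fun j =>
            ((hm1 j).add ((hdm (n j)).const_mul ((L j : ℝ≥0∞) + 1))).aemeasurable).trans
            (tsum_congr fun j => ?_)
          refine (lintegral_add_left (hm1 j) _).trans ?_
          rw [lintegral_const_mul _ (hdm (n j))]
      _ ≤ ∑' j, (∫⁻ x, ENNReal.ofReal (φ j x) ∂P + (η j + η j)) := by
          refine ENNReal.tsum_le_tsum fun j => ?_
          rw [← add_assoc]
          exact add_le_add ((setLIntegral_le_lintegral _ _).trans (hn2 j)) (hdist j)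
      _ = ∫⁻ x, ∑' j, ENNReal.ofReal (φ j x) ∂P + (∑' j, (η j : ℝ≥0∞) + ∑' j, (η j : ℝ≥0∞)) := by
          rw [ENNReal.tsum_add, ENNReal.tsum_add,
            lintegral_tsum fun j => (hφc j).measurable.ennreal_ofReal.aemeasurable]
      _ ≤ ∫⁻ x, U.indicator (fun _ => 1) x ∂P + (ε / 2 + ε / 2) := by
          gcongr with x
          refine ENNReal.tsum_le_of_sum_range_le fun N => ?_
          rw [← ENNReal.ofReal_sum_of_nonneg fun j _ => exhaustionStep_nonneg F j x,
            sum_range_exhaustionStep]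
          by_cases hx : x ∈ U
          · rw [indicator_of_mem hx, ← ENNReal.ofReal_one]
            exact ENNReal.ofReal_le_ofReal (exhaustion_le_one F N x)
          · rw [exhaustion_of_mem (by exact hx), ENNReal.ofReal_zero]
            exact zero_le
      _ = P U + ε := by
          rw [lintegral_indicator_const hU.measurableSet, one_mul, ENNReal.add_halves]

end Gluing

/-! ### The perimeter measures of almost all superlevel sets -/

section Disintegration

/-- If the distribution of `f` under a finite measure is absolutely continuous, the measure
disintegrates along the level sets of `f` over Lebesgue measure. -/
theorem exists_disintegration {X : Type*} [TopologicalSpace X] [MeasurableSpace X]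
    [StandardBorelSpace X] [Nonempty X] (μ : Measure X) [IsFiniteMeasure μ] {f : X → ℝ}
    (hf : Measurable f)
    (hac : volume.withDensity ((μ.map f).rnDeriv volume) = μ.map f) :
    ∃ P : ℝ → Measure X, (∀ t, P t univ = (μ.map f).rnDeriv volume t) ∧
      ∀ U, MeasurableSet U → ∀ᵐ t, ((μ.restrict U).map f).rnDeriv volume t = P t U := by
  have hfx : Measurable fun x => (f x, x) := hf.prodMk measurable_id
  set Λ : Measure (ℝ × X) := μ.map fun x => (f x, x) with hΛ
  have hfst : Λ.fst = μ.map f := by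
    rw [hΛ, Measure.fst, Measure.map_map measurable_fst hfx]
    rfl
  set D := (μ.map f).rnDeriv volume with hD
  have hDm : Measurable D := Measure.measurable_rnDeriv _ _
  refine ⟨fun t => D t • Λ.condKernel t, fun t => by simp, fun U hU => ?_⟩
  have hκm : Measurable fun t => Λ.condKernel t U := ProbabilityTheory.Kernel.measurable_coe _ hU
  have heq : (μ.restrict U).map f = volume.withDensity fun t => D t * Λ.condKernel t U := by
    ext J hJ
    have h1 : (μ.restrict U).map f J = Λ (J ×ˢ U) := by
      rw [Measure.map_apply hf hJ, Measure.restrict_apply (hf hJ), hΛ,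
        Measure.map_apply hfx (hJ.prod hU)]
      rfl
    rw [h1, withDensity_apply _ hJ]
    conv_lhs => rw [← Λ.disintegrate Λ.condKernel]
    rw [Measure.compProd_apply_prod hJ hU, hfst, ← hac,
      setLIntegral_withDensity_eq_setLIntegral_mul _ hDm hκm hJ]
    rfl
  rw [heq]
  exact Measure.rnDeriv_withDensity volume (hDm.mul hκm)

end Disintegration

section OpenFamily

/-- Countably many open sets such that every open set is an increasing union of some of them: the
finite unions of members of a countable basis. -/
theorem exists_countable_exhausting_family (X : Type*) [TopologicalSpace X]
    [SecondCountableTopology X] : ∃ W : Finset ℕ → Set X, (∀ s, IsOpen (W s)) ∧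
      ∀ U, IsOpen U → ∃ s : ℕ → Finset ℕ, Monotone (fun n => W (s n)) ∧ ⋃ n, W (s n) = U := by
  classical
  set b := TopologicalSpace.countableBasis X with hb
  obtain ⟨e, he⟩ := ((TopologicalSpace.countable_countableBasis X).insert ∅).exists_eq_range
    (insert_nonempty _ _)
  have heo : ∀ i, IsOpen (e i) := by
    intro i
    have : e i ∈ insert ∅ b := by rw [he]; exact mem_range_self i
    rcases this with h | h
    · rw [h]; exact isOpen_empty
    · exact TopologicalSpace.isOpen_of_mem_countableBasis h
  refine ⟨fun s => ⋃ i ∈ s, e i, fun s => isOpen_biUnion fun i _ => heo i, fun U hU => ?_⟩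
  refine ⟨fun n => (Finset.range n).filter fun i => e i ⊆ U, fun n k hnk => ?_, ?_⟩
  · refine biUnion_subset_biUnion_left fun i hi => ?_
    simp only [Finset.mem_coe, Finset.mem_filter, Finset.mem_range] at hi ⊢
    exact ⟨hi.1.trans_le hnk, hi.2⟩
  · refine Subset.antisymm (iUnion_subset fun n => iUnion₂_subset fun i hi =>
      (Finset.mem_filter.1 hi).2) fun x hx => ?_
    obtain ⟨V, hVb, hxV, hVU⟩ :=
      (TopologicalSpace.isBasis_countableBasis X).exists_subset_of_mem_open hx hU
    obtain ⟨i, rfl⟩ : V ∈ range e := by rw [← he]; exact Or.inr hVb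
    exact mem_iUnion.2 ⟨i + 1, mem_iUnion₂.2 ⟨i, by simp [hVU], hxV⟩⟩

end OpenFamily

section Final

variable {X : Type*} [MetricSpace X] [MeasurableSpace X] {m : Measure X}

theorem perimeterIn_mono {A U V : Set X} (h : V ⊆ U) : perimeterIn m A V ≤ perimeterIn m A U := by
  refine le_iInf fun u => le_iInf fun hu => le_iInf fun hlim => ?_
  refine (iInf₂_le_of_le u (fun n => (hu n).mono h) (iInf_le _ ?_)).trans
    (liminf_le_liminf (Eventually.of_forall fun n => lintegral_mono_set h))
  exact tendsto_of_tendsto_of_tendsto_of_le_of_le tendsto_const_nhds hlim (fun n => zero_le)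
    fun n => lintegral_mono_set h

theorem essBoundary_subset (hm : IsDoubling m) {f : X → ℝ} (hf : Continuous f) (t : ℝ) :
    essBoundary m {x | t ≤ f x} ⊆ f ⁻¹' {t} := by
  intro x hx
  by_contra hne
  refine hx ?_
  rcases lt_or_gt_of_ne (show f x ≠ t from hne) with h | h
  · right
    obtain ⟨ρ, hρ, hsub⟩ := Metric.mem_nhds_iff.1 (hf.continuousAt.eventually_lt_const h)
    refine tendsto_const_nhds.congr' ?_
    filter_upwards [Ioo_mem_nhdsGT hρ] with r hr
    have : Metric.ball x r ∩ {x | t ≤ f x} = ∅ := by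
      refine eq_empty_of_forall_notMem fun y hy => ?_
      have hyt : f y < t := hsub (Metric.ball_subset_ball hr.2.le hy.1)
      exact not_lt.2 hy.2 hyt
    rw [this, measure_empty, ENNReal.zero_div]
  · left
    obtain ⟨ρ, hρ, hsub⟩ := Metric.mem_nhds_iff.1 (hf.continuousAt.eventually_const_lt h)
    refine tendsto_const_nhds.congr' ?_
    filter_upwards [Ioo_mem_nhdsGT hρ] with r hr
    have : Metric.ball x r ∩ {x | t ≤ f x} = Metric.ball x r := by
      refine inter_eq_left.2 fun y hy => ?_
      have hyt : t < f y := hsub (Metric.ball_subset_ball hr.2.le hy)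
      exact hyt.le
    rw [this, ENNReal.div_self (hm.1 x r hr.1).1.ne' (hm.1 x r hr.1).2.ne]

variable [BorelSpace X]

theorem sphericalMeasure_apply {B : Set X} (hB : MeasurableSet B) :
    sphericalMeasure m B = sphericalOuter m B :=
  toMeasure_apply _ _ hB

theorem perimeter_le_liminf_levelApprox {f : X → ℝ} (hf : ∃ K : ℝ≥0, LipschitzWith K f) {a : ℝ}
    (hfin : m (f ⁻¹' Ioi a) < ∞) {t : ℝ} (hat : a < t) :
    perimeter m {x | t ≤ f x} ≤ liminf (fun n => ∫⁻ x, slope (levelApprox f a t n) x ∂m) atTop :=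
  iInf₂_le_of_le (levelApprox f a t) (exists_lipschitzWith_levelApprox hf t)
    (iInf_le _ (tendsto_levelApprox hf.choose_spec.continuous hfin hat))

/-- For almost every level above `a` the disintegration of `slopeMeasure m f a` provides the perimeter
measure, and it dominates the spherical measure on the essential boundary. -/
theorem VariationEqSlope.ae_exists_isPerimeterMeasure [CompleteSpace X] [Nonempty X]
    (hm : IsDoubling m) (hreg : VariationEqSlope m) {f : X → ℝ}
    (hf : ∃ K : ℝ≥0, LipschitzWith K f) {a : ℝ} (hfin : m (f ⁻¹' Ici a) < ∞) :
    ∀ᵐ t : ℝ, a < t → perimeter m {x | t ≤ f x} < ∞ ∧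
      ∃ P : Measure X, IsPerimeterMeasure m {x | t ≤ f x} P ∧
        (sphericalMeasure m).restrict (essBoundary m {x | t ≤ f x}) ≤ P := by
  have := hm.properSpace
  have := hm.isLocallyFiniteMeasure
  have hc : Continuous f := hf.choose_spec.continuous
  have hfin' : m (f ⁻¹' Ioi a) < ∞ :=
    (measure_mono (preimage_mono Ioi_subset_Ici_self)).trans_lt hfin
  have hμ := isFiniteMeasure_slopeMeasure hf hfin'
  have hmap : levelMeasure m f a univ = (slopeMeasure m f a).map f := by
    rw [levelMeasure, Measure.restrict_univ]
  obtain ⟨P, hPuniv, hP⟩ := exists_disintegration (slopeMeasure m f a) hc.measurable (by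
    rw [← hmap]
    exact (hreg.coarea hf hfin isOpen_univ).1)
  rw [← hmap] at hPuniv
  have hρ := isFiniteMeasure_levelMeasure hf hfin' univ
  obtain ⟨W, hWo, hW⟩ := exists_countable_exhausting_family X
  filter_upwards [ae_tendsto_levelMeasure_div (levelMeasure m f a univ) a,
    Measure.rnDeriv_lt_top (levelMeasure m f a univ) volume,
    ae_all_iff.2 fun s => (hreg.coarea hf hfin (hWo s)).2,
    ae_all_iff.2 fun s => hm.ae_sphericalOuter_le hf hfin' (hWo s) (hreg.coarea hf hfin (hWo s)).1,
    ae_all_iff.2 fun s => hP (W s) (hWo s).measurableSet] with t h1 h2 h3 h4 h5 hat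
  have hPfin : IsFiniteMeasure (P t) := ⟨by rw [hPuniv]; exact h2⟩
  have hsup : limsup (fun n => ∫⁻ x, slope (levelApprox f a t n) x ∂m) atTop ≤ P t univ := by
    rw [hPuniv, ← (h1 hat).limsup_eq]
    refine limsup_le_limsup (Eventually.of_forall fun n => ?_)
    have := lintegral_slope_levelApprox_le (m := m) hf hat n MeasurableSet.univ
    rwa [Measure.restrict_univ] at this
  -- the almost everywhere equality passes from the countable family to all open sets as an
  -- inequality only, because `perimeterIn` is not yet known to be continuous along unions
  have hle : ∀ U, IsOpen U → P t U ≤ perimeterIn m {x | t ≤ f x} U := by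
    intro U hU
    obtain ⟨s, hmono, rfl⟩ := hW U hU
    rw [hmono.measure_iUnion]
    refine iSup_le fun n => ?_
    rw [← h5 (s n)]
    change (levelMeasure m f a (W (s n))).rnDeriv volume t ≤ _
    rw [← h3 (s n) hat]
    exact perimeterIn_mono (subset_iUnion (fun n => W (s n)) n)
  have hPm : IsPerimeterMeasure m {x | t ≤ f x} (P t) := by
    refine ⟨hPfin, fun U hU => le_antisymm (hle U hU) ?_⟩
    exact perimeterIn_le_of_tendsto (hc.measurable measurableSet_Ici)
      (exists_lipschitzWith_levelApprox hf t) (tendsto_levelApprox hc hfin' hat)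
      (fun V hV => (hle V hV).trans (perimeterIn_le_liminf_levelApprox hf hfin' hat V)) hsup hU
  refine ⟨?_, P t, hPm, ?_⟩
  · exact ((perimeter_le_liminf_levelApprox hf hfin' hat).trans
      ((liminf_le_limsup).trans hsup)).trans_lt (measure_lt_top _ _)
  · have hSopen : ∀ U, IsOpen U → (sphericalMeasure m).restrict (f ⁻¹' {t}) U ≤ P t U := by
      intro U hU
      obtain ⟨s, hmono, rfl⟩ := hW U hU
      rw [hmono.measure_iUnion]
      refine iSup_le fun n => le_trans ?_ (measure_mono (subset_iUnion (fun n => W (s n)) n))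
      have hWm := (hWo (s n)).measurableSet
      rw [Measure.restrict_apply hWm, sphericalMeasure_apply
        (hWm.inter (hc.measurable (measurableSet_singleton t))), ← h5 (s n)]
      exact h4 (s n) hat
    refine (Measure.restrict_mono (essBoundary_subset hm hc t) le_rfl).trans
      (Measure.le_intro fun B hB _ => ?_)
    rw [B.measure_eq_iInf_isOpen (P t)]
    exact le_iInf₂ fun U hBU => le_iInf fun hU => (measure_mono hBU).trans (hSopen U hU)

end Final

end MetricBV

theorem corollary5p2 {X : Type*} [MetricSpace X] [CompleteSpace X] [MeasurableSpace X]
    [BorelSpace X] (m : Measure X) (hdoubling : MetricBV.IsDoubling m)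
    (hreg : MetricBV.VariationEqSlope m)
    (f : X → ℝ) (hLip : ∃ K : ℝ≥0, LipschitzWith K f) (hf : ∀ x, 0 ≤ f x)
    (hfin : m {x | 0 < f x} < ∞) :
    ∀ᵐ t : ℝ, 0 < t →
      MetricBV.perimeter m {x | t ≤ f x} < ∞ ∧
      ∃ P : Measure X, MetricBV.IsPerimeterMeasure m {x | t ≤ f x} P ∧
        (1 / 2 : ℝ≥0∞) •
            (MetricBV.sphericalMeasure m).restrict (MetricBV.essBoundary m {x | t ≤ f x}) ≤ P := by
  rcases isEmpty_or_nonempty X with hX | hX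
  · have h0 : m = 0 := Measure.eq_zero_of_isEmpty m
    refine Eventually.of_forall fun t _ => ⟨?_, 0, ⟨inferInstance, fun U _ => ?_⟩, fun B => ?_⟩
    · refine lt_of_le_of_lt (iInf₂_le_of_le (fun _ _ => 0) (fun n => ⟨0, LipschitzWith.const 0⟩)
        (iInf_le_of_le (a := 0) ?_ ?_)) ENNReal.zero_lt_top
      all_goals simp [h0]
    · refine le_antisymm zero_le (iInf₂_le_of_le (fun _ _ => 0)
        (fun n => (LipschitzWith.const 0).locallyLipschitz.locallyLipschitzOn) (iInf_le_of_le ?_ ?_))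
      all_goals simp [h0]
    · rw [Set.eq_empty_of_isEmpty B, measure_empty]
      exact zero_le
  -- the levels `a = 1 / (n + 1)` reach every `t > 0`, and `{a ≤ f}` has finite measure for each
  · have hlev : ∀ n : ℕ, m (f ⁻¹' Ici (1 / ((n : ℝ) + 1))) < ∞ := fun n =>
      (measure_mono fun x hx => (show (0 : ℝ) < 1 / (n + 1) by positivity).trans_le hx).trans_lt hfin
    filter_upwards [ae_all_iff.2 fun n => hreg.ae_exists_isPerimeterMeasure hdoubling hLip (hlev n)]
      with t ht h0
    obtain ⟨n, hn⟩ := exists_nat_one_div_lt h0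
    obtain ⟨h1, P, hP, hle⟩ := ht n hn
    refine ⟨h1, P, hP, le_trans (Measure.le_intro fun B _ _ => ?_) hle⟩
    rw [Measure.smul_apply, smul_eq_mul]
    exact mul_le_of_le_one_left zero_le (by simp)
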